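/- **Theorem 3.2 (oracle inequality and derived error bounds).** *Model.* Let $\Theta\subseteq\mathbb R^p$ be open and convex (for instance $\Theta=\mathbb R^p$), and for $\theta\in\Theta$ let $b_\theta:\mathbb R^d\to\mathbb R^d$ be locally Lipschitz, such that for each $x$ the map $\theta\mapsto b_\theta(x)$ is continuously differentiable on $\Theta$ with Jacobian $\dot b_\theta(x)\in\mathbb R^{d\times p}$ bounded on $K\times\{\|x\|\le R\}$ for all compact $K\subset\Theta$ and all $R>0$. Let $W$ be a $d$-dimensional Brownian motion with respect to a filtration on a probability space, let $\theta_0\in\Theta$, and let $X$ be an adapted continuous solution of $$dX_t=-b_{\theta_0}(X_t)\,dt+dW_t ,\qquad t\ge 0 .$$ Fix $T>0$ and put $\langle f,g\rangle_T=\frac1T\int_0^T f^\star(X_t)g(X_t)\,dt$, $\|f\|_T=\sqrt{\langle f,f\rangle_T}$. Write $\|\theta\|_0=\#\{j:\theta_j\ne0\}$. *Estimator.* Let $\lambda>0$ and let $\widehat\theta_L$ be a random element of $\Theta$ that almost surely minimises $\theta\mapsto\mathcal L_T(\theta)+\lambda\|\theta\|_1$ over $\Theta$, where $$\mathcal L_T(\theta)=\frac1T\int_0^T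 b_\theta^\star(X_t)\,dX_t+\frac1{2T}\int_0^T\|b_\theta(X_t)\|^2dt .$$ Here the random field $\theta\mapsto\int_0^T b_\theta^\star(X_t)\,dX_t$ is a separable version of the stochastic integrals: there is a countable $D\subseteq\Theta$ such that almost surely its graph over $D$ is dense in its graph over $\Theta$ (every version with continuous paths has this property). For $\int_0^T\dot b_\theta(X_t)^\star dW_t$, $\theta\in\Theta$, any versions may be taken. *Events.* Let $\gamma,k>0$ and $s\in\mathbb N_0$. For $c>0$ let $\mathcal C(s,c)=\{x\in\mathbb R^p\setminus\{0\}:\|x\|_1\le(1+c)\|x_{|\mathcal I_s(x)}\|_1\}$, where $\mathcal I_s(x)$ is a set of $s$ coordinates at which $|x_j|$ is largest. Define $$\mathcal T=\Big\{\sup_{\theta\in\Theta}\Big\|\frac1T\int_0^T\dot b_\theta(X_t)^\star dW_t\Big\|_\infty\le\frac\lambda2\Big\},\qquad \mathcal T'=\Big\{\inf_{\substack{\theta,\vartheta\in\Theta:\ \|\theta\|_0=s,\\ \theta-\vartheta\in\mathcal C(s,3+4/\gamma)}}\frac{\|b_\theta-b_\vartheta\|_T}{\|\theta-\vartheta\|_2}\ge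 k\Big\},$$ with $\inf\emptyset=+\infty$. *Claim.* Almost surely on $\mathcal T\cap\mathcal T'$ the following holds. (i) For every $\theta\in\Theta$ with $\|\theta\|_0=s$, $$\|b_{\widehat\theta_L}-b_{\theta_0}\|_T^2\le(1+\gamma)\|b_\theta-b_{\theta_0}\|_T^2+\frac{4(\gamma+2)^2s\lambda^2}{\gamma k^2}.$$ (ii) If $\|\theta_0\|_0=s$, then $$\|b_{\widehat\theta_L}-b_{\theta_0}\|_T^2\le\frac{4(\gamma+2)^2s\lambda^2}{\gamma k^2},\qquad \|\widehat\theta_L-\theta_0\|_2^2\le\frac{4(\gamma+2)^2s\lambda^2}{\gamma k^4},$$ $$\|\widehat\theta_L-\theta_0\|_1\le\frac{4(\gamma+1)}{\gamma}\sqrt s\,\|\widehat\theta_L-\theta_0\|_2 ,\qquad \|\widehat\theta_L-\theta_0\|_1\le\frac{8(\gamma+1)(\gamma+2)s\lambda}{\gamma^{3/2}k^2}.$$ -/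

import Mathlib

open MeasureTheory ProbabilityTheory Filter Topology
open scoped NNReal ENNReal

namespace LassoDiffusion

/-- The Euclidean space `ℝⁿ`. -/
abbrev E (n : ℕ) : Type := EuclideanSpace ℝ (Fin n)

noncomputable section

/-! ### Vectors: sparsity, `ℓ₁`-norm, the cone `𝒞(s, c)` -/

/-- `‖x‖₀`, the number of non-zero coordinates. -/
def l0 {p : ℕ} (x : E p) : ℕ := (Finset.univ.filter fun j => x j ≠ 0).card

/-- `‖x‖₁`. -/
def l1 {p : ℕ} (x : E p) : ℝ := ∑ j, |x j|

/-- `S` is a set of `s` coordinates at which `|x j|` is largest. -/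
def IsLargestCoords {p : ℕ} (s : ℕ) (x : E p) (S : Finset (Fin p)) : Prop :=
  S.card = s ∧ ∀ i ∈ S, ∀ j ∉ S, |x j| ≤ |x i|

/-- The cone `𝒞(s, c) = {x ≠ 0 : ‖x‖₁ ≤ (1 + c) ‖x|_{ℐ_s(x)}‖₁}`, with `ℐ_s(x)` a set of `s`
coordinates of largest absolute value (the choice among ties does not matter). -/
def cone (p s : ℕ) (c : ℝ) : Set (E p) :=
  {x | x ≠ 0 ∧ ∃ S, IsLargestCoords s x S ∧ l1 x ≤ (1 + c) * ∑ j ∈ S, |x j|}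

/-! ### The form `⟨f, g⟩_T` along a path -/

/-- `⟨f, g⟩_T = T⁻¹ ∫₀ᵀ f(x_t)⋆ g(x_t) dt` along the path `x`. -/
def pathInner {d : ℕ} (T : ℝ≥0) (x : ℝ≥0 → E d) (f g : E d → E d) : ℝ :=
  (1 / (T : ℝ)) * ∫ t in (0 : ℝ)..T, inner ℝ (f (x t.toNNReal)) (g (x t.toNNReal))

/-- `‖f‖_T = √⟨f, f⟩_T`. -/
def pathNorm {d : ℕ} (T : ℝ≥0) (x : ℝ≥0 → E d) (f : E d → E d) : ℝ :=
  Real.sqrt (pathInner T x f f)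

/-! ### Brownian motion and the stochastic integral -/

section Stochastic

variable {Ω : Type*} {mΩ : MeasurableSpace Ω}

/-- `W` is a standard `d`-dimensional Brownian motion with respect to the filtration `ℱ`. -/
structure IsBrownianMotion {d : ℕ} (ℱ : Filtration ℝ≥0 mΩ) (P : Measure Ω)
    (W : ℝ≥0 → Ω → E d) : Prop where
  adapted : ∀ t, Measurable[ℱ t] (W t)
  coord : ∀ i, IsBrownianReal (fun t ω => W t ω i) P
  indep_coord : iIndepFun (fun (i : Fin d) (ω : Ω) (t : ℝ≥0) => W t ω i) P
  indep_increment : ∀ s t, s ≤ t →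
    Indep (MeasurableSpace.comap (fun ω => W t ω - W s ω) inferInstance) (ℱ s) P

/-- A simple (elementary, bounded, adapted) `ℝᵈ`-valued process on `(0, T]`:
`∑_{i < n} val_i 1_{(time_i, time_{i+1}]}` with `val_i` bounded and `ℱ_{time_i}`-measurable. -/
structure SimpleIntegrand (ℱ : Filtration ℝ≥0 mΩ) (T : ℝ≥0) (d : ℕ) where
  n : ℕ
  time : ℕ → ℝ≥0
  time_mono : Monotone time
  time_le : ∀ i, time i ≤ T
  val : ℕ → Ω → E d
  val_measurable : ∀ i, Measurable[ℱ (time i)] (val i)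
  val_bounded : ∃ C : ℝ, ∀ i ω, ‖val i ω‖ ≤ C

/-- The simple process as a function of time and `ω`. -/
def SimpleIntegrand.eval {ℱ : Filtration ℝ≥0 mΩ} {T : ℝ≥0} {d : ℕ}
    (S : SimpleIntegrand ℱ T d) (t : ℝ≥0) (ω : Ω) : E d :=
  ∑ i ∈ Finset.range S.n,
    (Set.Ioc (S.time i) (S.time (i + 1))).indicator (fun _ => S.val i ω) t

/-- The elementary integral `∑_i val_i⋆ (Z_{time_{i+1}} - Z_{time_i})`. -/
def SimpleIntegrand.integral {ℱ : Filtration ℝ≥0 mΩ} {T : ℝ≥0} {d : ℕ}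
    (S : SimpleIntegrand ℱ T d) (Z : ℝ≥0 → Ω → E d) (ω : Ω) : ℝ :=
  ∑ i ∈ Finset.range S.n,
    inner ℝ (S.val i ω) (Z (S.time (i + 1)) ω - Z (S.time i) ω)

/-- `I` is a version of the Itô integral `∫₀ᵀ H_t⋆ dZ_t`: there are simple processes `Sⁿ` with
`∫₀ᵀ ‖Sⁿ_t - H_t‖² dt → 0` and `∫₀ᵀ (Sⁿ_t)⋆ dZ_t → I`, both in probability. This is used for `Z` a
Brownian motion, and for `Z` a Brownian motion plus a drift `∫₀ᵗ a_s ds` with `∫₀ᵀ ‖a_s‖² ds < ∞`;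
for such `Z` the limit does not depend, up to null sets, on the approximating sequence. -/
def IsItoIntegral {d : ℕ} (ℱ : Filtration ℝ≥0 mΩ) (P : Measure Ω) (T : ℝ≥0)
    (Z H : ℝ≥0 → Ω → E d) (I : Ω → ℝ) : Prop :=
  ∃ S : ℕ → SimpleIntegrand ℱ T d,
    (∀ ε : ℝ≥0∞, 0 < ε → Tendsto (fun n => P {ω | ε ≤ ∫⁻ t in Set.Ioc (0 : ℝ) T,
        ‖(S n).eval t.toNNReal ω - H t.toNNReal ω‖ₑ ^ 2}) atTop (𝓝 0)) ∧
    TendstoInMeasure P (fun n => (S n).integral Z) atTop I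

/-- Doob separability of a real random field over `Θ`: for some countable `D ⊆ Θ`, almost surely
the graph over `D` is dense in the graph over `Θ`. Fields with continuous paths are separable. -/
def IsSeparableField {p : ℕ} (Θ : Set (E p)) (P : Measure Ω) (I : E p → Ω → ℝ) : Prop :=
  ∃ D : Set (E p), D.Countable ∧ D ⊆ Θ ∧
    ∀ᵐ ω ∂P, ∀ θ ∈ Θ, (θ, I θ ω) ∈ closure ((fun q => (q, I q ω)) '' D)

/-! ### The model -/

/-- The drift: `b_θ(x)` is locally Lipschitz in `x` and continuously differentiable in `θ ∈ Θ`, and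
its `θ`-derivative is bounded on compact subsets of `Θ × ℝᵈ`. -/
structure IsRegularDrift {p d : ℕ} (Θ : Set (E p)) (b : E p → E d → E d) : Prop where
  locallyLipschitz : ∀ θ ∈ Θ, LocallyLipschitz (b θ)
  contDiffOn : ∀ x, ContDiffOn ℝ 1 (fun θ => b θ x) Θ
  deriv_bounded : ∀ K ⊆ Θ, IsCompact K → ∀ R : ℝ, ∃ C : ℝ, ∀ θ ∈ K, ∀ x, ‖x‖ ≤ R →
    ‖fderiv ℝ (fun ϑ => b ϑ x) θ‖ ≤ C

/-- The `j`-th column of the Jacobian `ḃ_θ(x)`, that is `∂b_θ(x)/∂θ_j`. -/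
def driftDeriv {p d : ℕ} (b : E p → E d → E d) (θ : E p) (j : Fin p) (x : E d) : E d :=
  fderiv ℝ (fun ϑ => b ϑ x) θ (EuclideanSpace.single j 1)

/-- `X` is an adapted continuous solution of `dX_t = -a(X_t) dt + dW_t`. -/
structure IsSolution {d : ℕ} (ℱ : Filtration ℝ≥0 mΩ) (P : Measure Ω) (a : E d → E d)
    (W X : ℝ≥0 → Ω → E d) : Prop where
  adapted : ∀ t, Measurable[ℱ t] (X t)
  continuous_paths : ∀ᵐ ω ∂P, Continuous fun t => X t ω
  eq : ∀ᵐ ω ∂P, ∀ t : ℝ≥0,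
    X t ω = X 0 ω - (∫ u in (0 : ℝ)..t, a (X u.toNNReal ω)) + W t ω

/-! ### The Lasso estimator and the two events -/

/-- The scaled negative log-likelihood
`ℒ_T(θ) = T⁻¹ ∫₀ᵀ b_θ(X_t)⋆ dX_t + (2T)⁻¹ ∫₀ᵀ ‖b_θ(X_t)‖² dt`, where `I θ` stands for (a version
of) the stochastic integral. -/
def negLogLik {p d : ℕ} (b : E p → E d → E d) (X : ℝ≥0 → Ω → E d) (T : ℝ≥0)
    (I : E p → Ω → ℝ) (θ : E p) (ω : Ω) : ℝ :=
  (1 / (T : ℝ)) * I θ ω +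
    (1 / (2 * (T : ℝ))) * ∫ t in (0 : ℝ)..T, ‖b θ (X t.toNNReal ω)‖ ^ 2

/-- `θhat` is a Lasso estimator: a.s. a minimiser over `Θ` of `ℒ_T(θ) + lam ‖θ‖₁`. -/
def IsLasso {p : ℕ} (Θ : Set (E p)) (P : Measure Ω) (L : E p → Ω → ℝ) (lam : ℝ)
    (θhat : Ω → E p) : Prop :=
  ∀ᵐ ω ∂P, θhat ω ∈ Θ ∧ ∀ θ ∈ Θ, L (θhat ω) ω + lam * l1 (θhat ω) ≤ L θ ω + lam * l1 θ

/-- The event `𝒯`: `sup_{θ ∈ Θ} ‖T⁻¹ ∫₀ᵀ ḃ_θ(X_t)⋆ dW_t‖_∞ ≤ lam / 2`, where `J θ j` stands for (a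
version of) the `j`-th coordinate `∫₀ᵀ ḃ_{θ,j}(X_t)⋆ dW_t` of the stochastic integral. -/
def gradEvent {p : ℕ} (Θ : Set (E p)) (T : ℝ≥0) (J : E p → Fin p → Ω → ℝ) (lam : ℝ) : Set Ω :=
  {ω | ∀ θ ∈ Θ, ∀ j, |(1 / (T : ℝ)) * J θ j ω| ≤ lam / 2}

/-- The event `𝒯'`: the infimum of `‖b_θ - b_ϑ‖_T / ‖θ - ϑ‖₂` over `θ, ϑ ∈ Θ` with `‖θ‖₀ = s` and
`θ - ϑ ∈ 𝒞(s, 3 + 4/γ)` is at least `k` (the infimum over the empty set being `+∞`). -/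
def eigenEvent {p d : ℕ} (Θ : Set (E p)) (b : E p → E d → E d) (X : ℝ≥0 → Ω → E d) (T : ℝ≥0)
    (s : ℕ) (γ k : ℝ) : Set Ω :=
  {ω | ∀ θ ∈ Θ, ∀ ϑ ∈ Θ, l0 θ = s → θ - ϑ ∈ cone p s (3 + 4 / γ) →
    k ≤ pathNorm T (fun t => X t ω) (fun x => b θ x - b ϑ x) / ‖θ - ϑ‖}

end Stochastic

end

end LassoDiffusion

/-!
The mathematical content is a pathwise inequality for the noise and a deterministic Lasso
argument.

*Noise.* Write `M_θ = ∫₀ᵀ b_θ(X_t)⋆ dW_t`. On `𝒯` the gradient of `θ ↦ M_θ` is bounded by `T λ /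
2` in the maximum norm, so one expects `|M_θ - M_ϑ| ≤ (T λ / 2) ‖θ - ϑ‖₁`. The stochastic
integrals are only versions, with no regularity in `θ`, so the mean value theorem is not
available pathwise. For fixed `θ, ϑ` the increment `b_θ - b_ϑ` is the pointwise limit of the
Riemann sums of `∫₀¹ ḃ_{ϑ + u(θ - ϑ)} (θ - ϑ) du`, locally boundedly in the state, hence the
limit in `L²(0, T)` along almost every path. By continuity of the Itô integral in probability
the corresponding combinations of the `∫₀ᵀ ḃ_θ(X_t)⋆ dW_t` converge almost surely along a
subsequence to `M_θ - M_ϑ`, and on `𝒯` each of them satisfies the bound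
(`ae_abs_sub_le_of_mem_gradEvent`). Separability of the field of integrals against `X`, together
with continuity in `θ` of the drift correction `∫₀ᵀ b_θ(X_t)⋆ b_{θ₀}(X_t) dt`, extends the bound
from countably many pairs to all pairs, outside a single null set
(`ae_forall_abs_sub_le_of_mem_gradEvent`).

The facts about the Itô integral are derived from the definition by simple processes: linearity
by common refinement of partitions, continuity by a Lenglart inequality for simple processes
(`SimpleIntegrand.measure_integral_ge_le`, `IsItoIntegral.exists_seq_ae_tendsto_zero`).
Integrals against `X` are turned into integrals against `W` by `IsItoIntegral.add_drift`.

*Lasso.* Completing the square gives `ℒ_T(θ) = M_θ / T + ½ ‖b_θ - b_{θ₀}‖_T² - ½ ‖b_{θ₀}‖_T²`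
(`negLogLik_eq`). Comparing the minimiser `η` with a competitor `θ` of support `S` yields, with
`Δ = η - θ`, `‖b_η - b_{θ₀}‖_T² + λ ‖Δ‖₁ ≤ ‖b_θ - b_{θ₀}‖_T² + 4 λ ‖Δ|_S‖₁`
(`basic_inequality`). Either the last term is at most `γ ‖b_θ - b_{θ₀}‖_T²`, or `Δ` lies in the
cone of the restricted eigenvalue condition `𝒯'` and the last term is absorbed by Young's
inequality (`oracle_of_basic`). For `θ = θ₀` the restricted eigenvalue condition also turns the
bound on the drift into bounds on `Δ` (`error_bounds_of_basic`).
-/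

namespace LassoDiffusion

noncomputable section

/-! ### Convergence to zero in outer probability -/

/-- Convergence to `0` in probability of `[0, ∞]`-valued functions, which need not be measurable.
Both limits in the definition of `IsItoIntegral` are of this form. -/
def TendstoZeroInProb {Ω : Type*} {mΩ : MeasurableSpace Ω} (P : Measure Ω)
    (f : ℕ → Ω → ℝ≥0∞) : Prop :=
  ∀ ε : ℝ≥0∞, 0 < ε → Tendsto (fun n => P {ω | ε ≤ f n ω}) atTop (𝓝 0)

namespace TendstoZeroInProb

variable {Ω : Type*} {mΩ : MeasurableSpace Ω} {P : Measure Ω} {f g : ℕ → Ω → ℝ≥0∞}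

lemma mono (hf : TendstoZeroInProb P f) (hgf : ∀ n, ∀ᵐ ω ∂P, g n ω ≤ f n ω) :
    TendstoZeroInProb P g := by
  intro ε hε
  refine tendsto_of_tendsto_of_tendsto_of_le_of_le tendsto_const_nhds (hf ε hε)
    (fun _ => zero_le) fun n => measure_mono_ae ?_
  filter_upwards [hgf n] with ω hω h using le_trans h hω

lemma add (hf : TendstoZeroInProb P f) (hg : TendstoZeroInProb P g) :
    TendstoZeroInProb P (fun n ω => f n ω + g n ω) := by
  intro ε hε
  have h2 : 0 < ε / 2 := ENNReal.half_pos hε.ne'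
  have h := (hf _ h2).add (hg _ h2)
  rw [add_zero] at h
  refine tendsto_of_tendsto_of_tendsto_of_le_of_le tendsto_const_nhds h
    (fun _ => zero_le) fun n => (measure_mono ?_).trans (measure_union_le _ _)
  intro ω hω
  by_contra hc
  simp only [Set.mem_union, Set.mem_ofPred_eq, not_or, not_le] at hc hω
  have := ENNReal.add_lt_add hc.1 hc.2
  rw [ENNReal.add_halves] at this
  exact absurd hω (not_le.2 this)

lemma const_mul (hf : TendstoZeroInProb P f) {c : ℝ≥0∞} (hc : c ≠ ∞) :
    TendstoZeroInProb P (fun n ω => c * f n ω) := by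
  intro ε hε
  rcases eq_or_ne c 0 with rfl | hc0
  · simp [hε.ne']
  · refine (hf (ε / c) (ENNReal.div_pos hε.ne' hc)).congr fun n => ?_
    congr 1
    ext ω
    simp only [Set.mem_ofPred_eq]
    rw [ENNReal.div_le_iff hc0 hc, mul_comm]

lemma comp (hf : TendstoZeroInProb P f) {ns : ℕ → ℕ} (hns : StrictMono ns) :
    TendstoZeroInProb P (fun n => f (ns n)) :=
  fun ε hε => (hf ε hε).comp hns.tendsto_atTop

lemma exists_lt (hf : TendstoZeroInProb P f) {ε δ : ℝ≥0∞} (hε : 0 < ε) (hδ : 0 < δ) :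
    ∃ N, ∀ n ≥ N, P {ω | ε ≤ f n ω} < δ :=
  eventually_atTop.1 ((hf ε hε).eventually (gt_mem_nhds hδ))

end TendstoZeroInProb

/-- Borel–Cantelli: exceptional sets of probability at most `2⁻ⁿ` force almost sure convergence. -/
lemma ae_tendsto_zero_of_measure_le {Ω : Type*} {mΩ : MeasurableSpace Ω} {P : Measure Ω}
    {f : ℕ → Ω → ℝ≥0∞}
    (h : ∀ n : ℕ, P {ω | ((n : ℝ≥0∞) + 1)⁻¹ ≤ f n ω} ≤ (2⁻¹ : ℝ≥0∞) ^ n) :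
    ∀ᵐ ω ∂P, Tendsto (fun n => f n ω) atTop (𝓝 0) := by
  have hs : ∑' n : ℕ, P {ω | ((n : ℝ≥0∞) + 1)⁻¹ ≤ f n ω} ≠ ∞ := by
    refine ne_top_of_le_ne_top ?_ (ENNReal.tsum_le_tsum h)
    rw [ENNReal.tsum_geometric, ENNReal.one_sub_inv_two, inv_inv]
    simp
  filter_upwards [ae_eventually_notMem hs] with ω hω
  have hlim : Tendsto (fun n : ℕ => ((n : ℝ≥0∞) + 1)⁻¹) atTop (𝓝 0) := by
    have := (ENNReal.tendsto_inv_nat_nhds_zero).comp (tendsto_add_atTop_nat 1)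
    simpa [Function.comp_def] using this
  refine tendsto_of_tendsto_of_tendsto_of_le_of_le' tendsto_const_nhds hlim
    (Eventually.of_forall fun _ => zero_le) ?_
  filter_upwards [hω] with n hn
  exact (not_le.1 hn).le

lemma inv_nat_add_one_pos (n : ℕ) : (0 : ℝ≥0∞) < ((n : ℝ≥0∞) + 1)⁻¹ :=
  ENNReal.inv_pos.2 (by finiteness)

lemma TendstoZeroInProb.exists_seq_ae {Ω : Type*} {mΩ : MeasurableSpace Ω} {P : Measure Ω}
    {f : ℕ → Ω → ℝ≥0∞} (hf : TendstoZeroInProb P f) :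
    ∃ ns : ℕ → ℕ, StrictMono ns ∧ ∀ᵐ ω ∂P, Tendsto (fun n => f (ns n) ω) atTop (𝓝 0) := by
  obtain ⟨ns, hns, h⟩ := extraction_forall_of_eventually' (P := fun (n : ℕ) k =>
    P {ω | ((n : ℝ≥0∞) + 1)⁻¹ ≤ f k ω} ≤ (2⁻¹ : ℝ≥0∞) ^ n) (fun n => by
      obtain ⟨N, hN⟩ := hf.exists_lt (inv_nat_add_one_pos n)
        (δ := (2⁻¹ : ℝ≥0∞) ^ n) (ENNReal.pow_pos (by simp) n)
      exact ⟨N, fun k hk => (hN k hk).le⟩)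
  exact ⟨ns, hns, ae_tendsto_zero_of_measure_le h⟩

lemma tendstoZeroInProb_of_ae {Ω : Type*} {mΩ : MeasurableSpace Ω} {P : Measure Ω}
    [IsFiniteMeasure P] {f : ℕ → Ω → ℝ≥0∞} (hf : ∀ n, AEMeasurable (f n) P)
    (h : ∀ᵐ ω ∂P, Tendsto (fun n => f n ω) atTop (𝓝 0)) : TendstoZeroInProb P f := by
  intro ε hε
  set δ : ℝ≥0∞ := min ε 1
  have hδ : 0 < δ := lt_min hε one_pos
  have hδt : δ ≠ ∞ := ne_top_of_le_ne_top ENNReal.one_ne_top (min_le_right _ _)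
  -- truncation at `1` turns the statement into convergence in measure of real functions
  have hm : TendstoInMeasure P (fun n ω => (min (f n ω) 1).toReal) atTop (fun _ => 0) := by
    refine tendstoInMeasure_of_tendsto_ae
      (fun n => ((hf n).min aemeasurable_const).ennreal_toReal.aestronglyMeasurable) ?_
    filter_upwards [h] with ω hω
    have := (ENNReal.tendsto_toReal (a := 0) (by simp)).comp
      ((hω.min tendsto_const_nhds).trans (by simp) :
        Tendsto (fun n => min (f n ω) 1) atTop (𝓝 0))
    simpa [Function.comp_def] using this
  refine tendsto_of_tendsto_of_tendsto_of_le_of_le tendsto_const_nhds (hm δ hδ)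
    (fun _ => zero_le) fun n => measure_mono fun ω hω => ?_
  simp only [Set.mem_ofPred_eq] at hω ⊢
  rw [edist_dist, dist_zero_right, Real.norm_of_nonneg ENNReal.toReal_nonneg,
    ENNReal.ofReal_toReal (by simp)]
  exact min_le_min_right _ hω

/-! ### Simple integrands: bilinear sums, refinement, sums and multiples -/

lemma exists_monotone_enum (F : Finset ℝ≥0) (hF : F.Nonempty) :
    ∃ (τ : ℕ → ℝ≥0) (N : ℕ), Monotone τ ∧ (∀ j, τ j ∈ F) ∧ ∀ t ∈ F, ∃ j ≤ N, τ j = t := by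
  have hc : 0 < F.card := hF.card_pos
  refine ⟨fun j => F.orderEmbOfFin rfl ⟨min j (F.card - 1), by omega⟩, F.card - 1, ?_, ?_, ?_⟩
  · intro i j hij
    simp only [OrderEmbedding.le_iff_le, Fin.mk_le_mk]
    omega
  · exact fun j => Finset.orderEmbOfFin_mem _ _ _
  · intro t ht
    have : t ∈ Set.range (F.orderEmbOfFin rfl) := by
      rw [Finset.range_orderEmbOfFin]; exact ht
    obtain ⟨i, rfl⟩ := this
    refine ⟨i, Nat.le_sub_one_of_lt i.2, ?_⟩
    exact congrArg (F.orderEmbOfFin rfl) (Fin.ext (min_eq_left (Nat.le_sub_one_of_lt i.2)))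

lemma sum_indicator_Ioc_telescope {M : Type*} [AddCommGroup M] {τ : ℕ → ℝ≥0} (hτ : Monotone τ)
    {N m n : ℕ} (hm : m ≤ n) (hn : n ≤ N) (f : ℝ≥0 → M) :
    ∑ j ∈ Finset.range N, (Set.Ioc (τ m) (τ n)).indicator
      (fun _ => f (τ (j + 1)) - f (τ j)) (τ (j + 1)) = f (τ n) - f (τ m) := by
  -- each term is the increment of `f` composed with the clamp onto `[τ m, τ n]`
  set g : ℝ≥0 → M := fun t => f (max (τ m) (min (τ n) t)) with hg
  have hmn : τ m ≤ τ n := hτ hm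
  have key : ∀ j ∈ Finset.range N, (Set.Ioc (τ m) (τ n)).indicator
      (fun _ => f (τ (j + 1)) - f (τ j)) (τ (j + 1)) = g (τ (j + 1)) - g (τ j) := by
    intro j _
    have hj : τ j ≤ τ (j + 1) := hτ (Nat.le_succ j)
    by_cases h : τ (j + 1) ∈ Set.Ioc (τ m) (τ n)
    · rw [Set.indicator_of_mem h]
      have hmj : τ m ≤ τ j := by
        rcases le_or_gt m j with h' | h'
        · exact hτ h'
        · exact absurd h.1 (not_lt.2 (hτ h'))
      simp only [hg]
      rw [min_eq_right h.2, min_eq_right (hj.trans h.2), max_eq_right hmj,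
        max_eq_right (hmj.trans hj)]
    · rw [Set.indicator_of_notMem h]
      simp only [hg]
      rw [Set.mem_Ioc, not_and_or, not_lt, not_le] at h
      rcases h with h | h
      · rw [max_eq_left ((min_le_right _ _).trans h),
          max_eq_left ((min_le_right _ _).trans (hj.trans h)), sub_self]
      · have hnj : τ n ≤ τ j := by
          rcases le_or_gt n j with h' | h'
          · exact hτ h'
          · exact absurd h (not_lt.2 (hτ h'))
        rw [min_eq_left h.le, min_eq_left hnj, sub_self]
  rw [Finset.sum_congr rfl key, Finset.sum_range_sub (fun j => g (τ j))]
  simp only [hg]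
  rw [min_eq_left (hτ hn), max_eq_right hmn, min_eq_right (hτ (Nat.zero_le _)),
    max_eq_left (hτ (Nat.zero_le _))]

namespace SimpleIntegrand

variable {Ω : Type*} {mΩ : MeasurableSpace Ω} {ℱ : Filtration ℝ≥0 mΩ} {T : ℝ≥0} {d : ℕ}

/-- The sum `∑_i β(val_i, z(time_{i+1}) - z(time_i))` for a bilinear map `β` and a path `z` with
values in any module. The elementary integral and the value of the process at a fixed time are
both of this form. -/
def bilinSum {M G : Type*} [AddCommGroup M] [Module ℝ M] [AddCommGroup G] [Module ℝ G]
    (S : SimpleIntegrand ℱ T d) (β : E d →ₗ[ℝ] M →ₗ[ℝ] G) (z : ℝ≥0 → M) (ω : Ω) : G :=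
  ∑ i ∈ Finset.range S.n, β (S.val i ω) (z (S.time (i + 1)) - z (S.time i))

lemma integral_eq_bilinSum (S : SimpleIntegrand ℱ T d) (Z : ℝ≥0 → Ω → E d) (ω : Ω) :
    S.integral Z ω = S.bilinSum (innerₗ (E d)) (fun t => Z t ω) ω := by
  simp [integral, bilinSum]

/-- The value at time `t` is the "integral" of the process against the step path `1_{t ≤ ·}`. -/
lemma eval_eq_bilinSum (S : SimpleIntegrand ℱ T d) (t : ℝ≥0) (ω : Ω) :
    S.eval t ω = S.bilinSum (LinearMap.lsmul ℝ (E d)).flip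
      (fun u => if t ≤ u then (1 : ℝ) else 0) ω := by
  simp only [eval, bilinSum, LinearMap.flip_apply, LinearMap.lsmul_apply]
  refine Finset.sum_congr rfl fun i _ => ?_
  have hi : S.time i ≤ S.time (i + 1) := S.time_mono (Nat.le_succ i)
  by_cases h1 : t ≤ S.time i
  · rw [Set.indicator_of_notMem (fun h : t ∈ Set.Ioc _ _ => absurd h.1 (not_lt.2 h1)), if_pos h1,
      if_pos (h1.trans hi)]
    simp
  · by_cases h2 : t ≤ S.time (i + 1)
    · have h3 : t ∈ Set.Ioc (S.time i) (S.time (i + 1)) := ⟨not_le.1 h1, h2⟩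
      rw [Set.indicator_of_mem h3, if_neg h1, if_pos h2]
      simp
    · rw [Set.indicator_of_notMem (fun h : t ∈ Set.Ioc _ _ => h2 h.2), if_neg h1, if_neg h2]
      simp

/-- Bilinear sums do not change when the partition is refined. -/
lemma sum_refine {M G : Type*} [AddCommGroup M] [Module ℝ M] [AddCommGroup G] [Module ℝ G]
    (S : SimpleIntegrand ℱ T d) (β : E d →ₗ[ℝ] M →ₗ[ℝ] G) (z : ℝ≥0 → M) (ω : Ω)
    {τ : ℕ → ℝ≥0} (hτ : Monotone τ) {N : ℕ} (hS : ∀ i ≤ S.n, ∃ j ≤ N, τ j = S.time i) :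
    ∑ j ∈ Finset.range N, β (S.eval (τ (j + 1)) ω) (z (τ (j + 1)) - z (τ j)) =
      S.bilinSum β z ω := by
  simp only [eval, map_sum, LinearMap.sum_apply, bilinSum]
  rw [Finset.sum_comm]
  refine Finset.sum_congr rfl fun i hi => ?_
  rw [Finset.mem_range] at hi
  obtain ⟨m, hm, hm'⟩ := hS i hi.le
  obtain ⟨n, hn, hn'⟩ := hS (i + 1) hi
  have hi' : S.time i ≤ S.time (i + 1) := S.time_mono (Nat.le_succ i)
  rw [← hm', ← hn'] at hi' ⊢
  rcases le_total m n with hmn | hmn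
  · rw [map_sub, ← sum_indicator_Ioc_telescope hτ hmn hn fun t => β (S.val i ω) (z t)]
    refine Finset.sum_congr rfl fun j _ => ?_
    by_cases h : τ (j + 1) ∈ Set.Ioc (τ m) (τ n)
    · simp [Set.indicator_of_mem h]
    · simp [Set.indicator_of_notMem h]
  · have : τ n = τ m := le_antisymm (hτ hmn) hi'
    simp [this]

lemma eval_bounded (S : SimpleIntegrand ℱ T d) : ∃ C : ℝ, ∀ t ω, ‖S.eval t ω‖ ≤ C := by
  obtain ⟨C, hC⟩ := S.val_bounded
  refine ⟨∑ _i ∈ Finset.range S.n, C, fun t ω => norm_sum_le_of_le _ fun i _ => ?_⟩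
  exact (norm_indicator_le_norm_self _ _).trans (hC i ω)

lemma measurable_eval_of_range {S : SimpleIntegrand ℱ T d} {τ : ℕ → ℝ≥0} (hτ : Monotone τ)
    (hS : ∀ i ≤ S.n, ∃ j, τ j = S.time i) (j : ℕ) :
    Measurable[ℱ (τ j)] (S.eval (τ (j + 1))) := by
  have : S.eval (τ (j + 1)) = fun ω => ∑ i ∈ Finset.range S.n,
      (Set.Ioc (S.time i) (S.time (i + 1))).indicator (fun _ => S.val i ω) (τ (j + 1)) := rfl
  rw [this]
  refine Finset.measurable_fun_sum _ fun i hi => ?_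
  by_cases h : τ (j + 1) ∈ Set.Ioc (S.time i) (S.time (i + 1))
  · simp only [Set.indicator_of_mem h]
    obtain ⟨m, hm⟩ := hS i (Finset.mem_range.1 hi).le
    have hle : S.time i ≤ τ j := by
      rw [← hm]
      rcases le_or_gt m j with h' | h'
      · exact hτ h'
      · exact absurd h.1 (not_lt.2 (hm ▸ hτ h'))
    exact (S.val_measurable i).mono (ℱ.mono hle) le_rfl
  · simp only [Set.indicator_of_notMem h]
    exact measurable_const

lemma exists_add (S S' : SimpleIntegrand ℱ T d) : ∃ R : SimpleIntegrand ℱ T d,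
    (∀ t ω, R.eval t ω = S.eval t ω + S'.eval t ω) ∧
    ∀ (Z : ℝ≥0 → Ω → E d) ω, R.integral Z ω = S.integral Z ω + S'.integral Z ω := by
  obtain ⟨τ, N, hτ, hF, hτF⟩ := exists_monotone_enum
    ((Finset.range (S.n + 1)).image S.time ∪ (Finset.range (S'.n + 1)).image S'.time)
    ⟨S.time 0, by simp only [Finset.mem_union, Finset.mem_image, Finset.mem_range]
                  exact Or.inl ⟨0, by omega, rfl⟩⟩
  have h1 : ∀ i ≤ S.n, ∃ j ≤ N, τ j = S.time i := fun i hi => hτF _ <| by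
    simp only [Finset.mem_union, Finset.mem_image, Finset.mem_range]
    exact Or.inl ⟨i, by omega, rfl⟩
  have h2 : ∀ i ≤ S'.n, ∃ j ≤ N, τ j = S'.time i := fun i hi => hτF _ <| by
    simp only [Finset.mem_union, Finset.mem_image, Finset.mem_range]
    exact Or.inr ⟨i, by omega, rfl⟩
  obtain ⟨C, hC⟩ := S.eval_bounded
  obtain ⟨C', hC'⟩ := S'.eval_bounded
  let R : SimpleIntegrand ℱ T d :=
    { n := N
      time := τ
      time_mono := hτ
      time_le := fun j => by
        have := hF j
        simp only [Finset.mem_union, Finset.mem_image, Finset.mem_range] at this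
        rcases this with ⟨i, -, hi⟩ | ⟨i, -, hi⟩
        · exact hi ▸ S.time_le i
        · exact hi ▸ S'.time_le i
      val := fun j ω => S.eval (τ (j + 1)) ω + S'.eval (τ (j + 1)) ω
      val_measurable := fun j =>
        (measurable_eval_of_range hτ (fun i hi => (h1 i hi).imp fun _ h => h.2) j).add
          (measurable_eval_of_range hτ (fun i hi => (h2 i hi).imp fun _ h => h.2) j)
      val_bounded := ⟨C + C', fun j ω =>
        (norm_add_le _ _).trans (add_le_add (hC _ _) (hC' _ _))⟩ }
  have key : ∀ {M G : Type} [AddCommGroup M] [Module ℝ M] [AddCommGroup G] [Module ℝ G]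
      (β : E d →ₗ[ℝ] M →ₗ[ℝ] G) (z : ℝ≥0 → M) (ω : Ω),
      R.bilinSum β z ω = S.bilinSum β z ω + S'.bilinSum β z ω := by
    intro M G _ _ _ _ β z ω
    rw [← S.sum_refine β z ω hτ h1, ← S'.sum_refine β z ω hτ h2, ← Finset.sum_add_distrib]
    simp [bilinSum, R]
  refine ⟨R, fun t ω => ?_, fun Z ω => ?_⟩
  · simp only [eval_eq_bilinSum, key]
  · simp only [integral_eq_bilinSum, key]

lemma exists_smul (c : ℝ) (S : SimpleIntegrand ℱ T d) : ∃ R : SimpleIntegrand ℱ T d,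
    (∀ t ω, R.eval t ω = c • S.eval t ω) ∧
    ∀ (Z : ℝ≥0 → Ω → E d) ω, R.integral Z ω = c * S.integral Z ω := by
  obtain ⟨C, hC⟩ := S.val_bounded
  refine ⟨{ n := S.n
            time := S.time
            time_mono := S.time_mono
            time_le := S.time_le
            val := fun i ω => c • S.val i ω
            val_measurable := fun i => (S.val_measurable i).const_smul c
            val_bounded := ⟨|c| * C, fun i ω => by
              rw [norm_smul, Real.norm_eq_abs]
              exact mul_le_mul_of_nonneg_left (hC i ω) (abs_nonneg c)⟩ }, ?_, ?_⟩
  · intro t ω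
    simp only [eval_eq_bilinSum, bilinSum, Finset.smul_sum, map_smul, LinearMap.smul_apply]
  · intro Z ω
    simp only [integral, Finset.mul_sum, real_inner_smul_left]

/-- The zero process, integrated over the empty partition. -/
def zero (ℱ : Filtration ℝ≥0 mΩ) (T : ℝ≥0) (d : ℕ) : SimpleIntegrand ℱ T d where
  n := 0
  time := fun _ => 0
  time_mono := fun _ _ _ => le_rfl
  time_le := fun _ => zero_le
  val := fun _ _ => 0
  val_measurable := fun _ => measurable_const
  val_bounded := ⟨0, fun _ _ => by simp⟩

lemma measurable_eval_left (S : SimpleIntegrand ℱ T d) (ω : Ω) :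
    Measurable fun t => S.eval t ω := by
  unfold eval
  exact Finset.measurable_fun_sum _ fun i _ => measurable_const.indicator measurableSet_Ioc

lemma eval_eq_val (S : SimpleIntegrand ℱ T d) {i : ℕ} (hi : i < S.n) {t : ℝ≥0}
    (ht : t ∈ Set.Ioc (S.time i) (S.time (i + 1))) (ω : Ω) : S.eval t ω = S.val i ω := by
  unfold eval
  rw [Finset.sum_eq_single_of_mem i (Finset.mem_range.2 hi), Set.indicator_of_mem ht]
  intro j _ hj
  refine Set.indicator_of_notMem (fun h => ?_) _
  exact Set.disjoint_left.1 (S.time_mono.pairwise_disjoint_on_Ioc_succ hj) h ht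

/-- The quadratic variation `∑_i ‖val_i‖² (time_{i+1} - time_i)` is at most `∫₀ᵀ ‖S_t‖² dt`. -/
lemma sum_sq_le_lintegral (S : SimpleIntegrand ℱ T d) (ω : Ω) :
    ∑ i ∈ Finset.range S.n, ‖S.val i ω‖ₑ ^ 2 * ((S.time (i + 1) - S.time i : ℝ≥0) : ℝ≥0∞) ≤
      ∫⁻ t in Set.Ioc (0 : ℝ) T, ‖S.eval t.toNNReal ω‖ₑ ^ 2 := by
  have hsub : (⋃ i ∈ Finset.range S.n, Set.Ioc (S.time i : ℝ) (S.time (i + 1))) ⊆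
      Set.Ioc (0 : ℝ) T := by
    refine Set.iUnion₂_subset fun i _ => Set.Ioc_subset_Ioc (by positivity) ?_
    exact_mod_cast S.time_le (i + 1)
  refine le_trans (le_of_eq ?_) (lintegral_mono_set hsub)
  rw [lintegral_biUnion_finset]
  · refine Finset.sum_congr rfl fun i hi => ?_
    rw [setLIntegral_congr_fun (g := fun _ => ‖S.val i ω‖ₑ ^ 2) measurableSet_Ioc]
    · rw [setLIntegral_const, Real.volume_Ioc, ← NNReal.coe_sub (S.time_mono (Nat.le_succ i)),
        ENNReal.ofReal_coe_nnreal]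
    · intro t ht
      simp only
      rw [S.eval_eq_val (Finset.mem_range.1 hi)]
      exact ⟨Real.lt_toNNReal_iff_coe_lt.2 ht.1, Real.toNNReal_le_iff_le_coe.2 ht.2⟩
  · have hm : Monotone fun i => (S.time i : ℝ) := fun i j h => by exact_mod_cast S.time_mono h
    exact hm.pairwise_disjoint_on_Ioc_succ.set_pairwise _
  · exact fun _ _ => measurableSet_Ioc

end SimpleIntegrand

/-! ### The elementary stochastic integral: second moments and a Lenglart inequality -/

section Increments

variable {Ω : Type*} {mΩ : MeasurableSpace Ω} {P : Measure Ω}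
  {ℱ : Filtration ℝ≥0 mΩ} {d : ℕ} {W : ℝ≥0 → Ω → E d}

lemma IsBrownianMotion.memLp_increment (hW : IsBrownianMotion ℱ P W) (s t : ℝ≥0) (i : Fin d) :
    MemLp (fun ω => W t ω i - W s ω i) 2 P :=
  (((hW.coord i).hasLaw_eval t).hasGaussianLaw.memLp_two).sub
    (((hW.coord i).hasLaw_eval s).hasGaussianLaw.memLp_two)

lemma IsBrownianMotion.integral_increment (hW : IsBrownianMotion ℱ P W) (s t : ℝ≥0)
    (i : Fin d) : ∫ ω, (W t ω i - W s ω i) ∂P = 0 := by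
  have h := ((hW.coord i).hasLaw_sub t s).integral_eq
  rw [integral_id_gaussianReal] at h
  exact h

lemma IsBrownianMotion.integral_increment_sq (hW : IsBrownianMotion ℱ P W) {s t : ℝ≥0}
    (hst : s ≤ t) (i : Fin d) : ∫ ω, (W t ω i - W s ω i) ^ 2 ∂P = (t : ℝ) - s := by
  have h := ((hW.coord i).hasLaw_sub t s).variance_eq
  rw [variance_id_gaussianReal, variance_eq_integral ((hW.coord i).hasLaw_sub t s).aemeasurable]
    at h
  have h0 : ∫ ω, ((fun ω => W t ω i) - fun ω => W s ω i) ω ∂P = 0 := hW.integral_increment s t i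
  rw [h0] at h
  simp only [Pi.sub_apply, sub_zero] at h
  rw [h]
  have : (0 : ℝ) ≤ (t : ℝ) - s := sub_nonneg.2 (by exact_mod_cast hst)
  change dist (t : ℝ) (s : ℝ) = _
  rw [Real.dist_eq, abs_of_nonneg this]

lemma IsBrownianMotion.memLp_increment_vec (hW : IsBrownianMotion ℱ P W) (s t : ℝ≥0) :
    MemLp (fun ω => W t ω - W s ω) 2 P := by
  refine MemLp.of_eval_piLp fun i => ?_
  simpa using hW.memLp_increment s t i

lemma IsBrownianMotion.integral_norm_increment_sq (hW : IsBrownianMotion ℱ P W) {s t : ℝ≥0}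
    (hst : s ≤ t) : ∫ ω, ‖W t ω - W s ω‖ ^ 2 ∂P = d * ((t : ℝ) - s) := by
  simp only [EuclideanSpace.norm_sq_eq, Real.norm_eq_abs, sq_abs, PiLp.sub_apply]
  rw [integral_finsetSum _ fun i _ => (hW.memLp_increment s t i).integrable_sq]
  simp [hW.integral_increment_sq hst, mul_sub]

lemma IsBrownianMotion.indepFun_increment (hW : IsBrownianMotion ℱ P W) {s t : ℝ≥0}
    (hst : s ≤ t) {β γ : Type*} {mβ : MeasurableSpace β} {mγ : MeasurableSpace γ}
    {Y : Ω → β} (hY : Measurable[ℱ s] Y) {φ : E d → γ} (hφ : Measurable φ) :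
    IndepFun Y (fun ω => φ (W t ω - W s ω)) P := by
  rw [IndepFun_iff_Indep]
  refine indep_of_indep_of_le_left (indep_of_indep_of_le_right (hW.indep_increment s t hst).symm
    ?_) hY.comap_le
  rintro _ ⟨u, hu, rfl⟩
  exact ⟨φ ⁻¹' u, hφ hu, rfl⟩

end Increments

namespace SimpleIntegrand

variable {Ω : Type*} {mΩ : MeasurableSpace Ω} {P : Measure Ω}
  {ℱ : Filtration ℝ≥0 mΩ} {T : ℝ≥0} {d : ℕ} {W : ℝ≥0 → Ω → E d}

lemma measurable_partial_integral (S : SimpleIntegrand ℱ T d) (hW : IsBrownianMotion ℱ P W)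
    (m : ℕ) : Measurable[ℱ (S.time m)] fun ω => ∑ i ∈ Finset.range m,
      inner ℝ (S.val i ω) (W (S.time (i + 1)) ω - W (S.time i) ω) := by
  refine Finset.measurable_fun_sum _ fun i hi => ?_
  have him : i < m := Finset.mem_range.1 hi
  have h1 := ℱ.mono (S.time_mono him.le)
  have h2 := ℱ.mono (S.time_mono (Nat.succ_le_of_lt him))
  exact Measurable.inner ((S.val_measurable i).mono h1 le_rfl)
    (((hW.adapted _).mono h2 le_rfl).sub ((hW.adapted _).mono h1 le_rfl))

lemma measurable_integral (S : SimpleIntegrand ℱ T d) (hW : IsBrownianMotion ℱ P W) :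
    Measurable (S.integral W) :=
  (S.measurable_partial_integral hW S.n).mono (ℱ.le _) le_rfl

/-- Half of the Itô isometry. The factor `d`, which the isometry does not have, comes from the
Cauchy–Schwarz bound `⟨v, ΔW⟩² ≤ ‖v‖² ‖ΔW‖²`; it avoids the cross moments of the coordinates. -/
lemma integral_sq_le [IsProbabilityMeasure P] (S : SimpleIntegrand ℱ T d)
    (hW : IsBrownianMotion ℱ P W) (m : ℕ) :
    MemLp (fun ω => ∑ i ∈ Finset.range m,
      inner ℝ (S.val i ω) (W (S.time (i + 1)) ω - W (S.time i) ω)) 2 P ∧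
    ∫ ω, (∑ i ∈ Finset.range m,
      inner ℝ (S.val i ω) (W (S.time (i + 1)) ω - W (S.time i) ω)) ^ 2 ∂P ≤
    d * ∫ ω, ∑ i ∈ Finset.range m,
      ‖S.val i ω‖ ^ 2 * ((S.time (i + 1) : ℝ) - S.time i) ∂P := by
  obtain ⟨C, hC⟩ := S.val_bounded
  have hnsq : Measurable fun x : E d => ‖x‖ ^ 2 := by fun_prop
  have hvm : ∀ i, Measurable (S.val i) := fun i => (S.val_measurable i).mono (ℱ.le _) le_rfl
  have hv2 : ∀ i, Integrable (fun ω => ‖S.val i ω‖ ^ 2) P := fun i =>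
    Integrable.of_bound ((hvm i).norm.pow_const 2).aestronglyMeasurable (C ^ 2)
      (ae_of_all _ fun ω => by
        rw [Real.norm_of_nonneg (by positivity)]
        exact pow_le_pow_left₀ (norm_nonneg _) (hC i ω) 2)
  induction m with
  | zero => simp
  | succ m ih =>
    obtain ⟨ihL, ihI⟩ := ih
    have hle : S.time m ≤ S.time (m + 1) := S.time_mono (Nat.le_succ m)
    set M : Ω → ℝ := fun ω => ∑ i ∈ Finset.range m,
      inner ℝ (S.val i ω) (W (S.time (i + 1)) ω - W (S.time i) ω) with hM
    set D : Ω → E d := fun ω => W (S.time (m + 1)) ω - W (S.time m) ω with hD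
    have hMm : Measurable[ℱ (S.time m)] M := S.measurable_partial_integral hW m
    have hDL : MemLp D 2 P := hW.memLp_increment_vec _ _
    have hincL : MemLp (fun ω => inner ℝ (S.val m ω) (D ω)) 2 P := by
      refine MemLp.of_le_mul (c := C) hDL ?_ (ae_of_all _ fun ω => ?_)
      · exact (hvm m).aestronglyMeasurable.inner hDL.aestronglyMeasurable
      · exact (norm_inner_le_norm _ _).trans
          (mul_le_mul_of_nonneg_right (hC m ω) (norm_nonneg _))
    have hcoord : ∀ k, ∀ ω, |S.val m ω k| ≤ C := fun k ω => by
      have := PiLp.norm_apply_le (S.val m ω) k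
      exact this.trans (hC m ω)
    have hMv : ∀ k, MemLp (fun ω => M ω * S.val m ω k) 2 P := fun k =>
      MemLp.of_le_mul (c := C) ihL (ihL.aestronglyMeasurable.mul
        (by exact ((measurable_pi_apply k).comp
          ((WithLp.measurable_ofLp 2 _).comp (hvm m))).aestronglyMeasurable))
        (ae_of_all _ fun ω => by
          rw [norm_mul, mul_comm]
          exact mul_le_mul_of_nonneg_right (hcoord k ω) (norm_nonneg _))
    have hcross : ∫ ω, M ω * inner ℝ (S.val m ω) (D ω) ∂P = 0 := by
      have hexp : ∀ ω, M ω * inner ℝ (S.val m ω) (D ω) =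
          ∑ k, (M ω * S.val m ω k) * (D ω k) := fun ω => by
        rw [PiLp.inner_apply, Finset.mul_sum]
        refine Finset.sum_congr rfl fun k _ => ?_
        simp only [RCLike.inner_apply, conj_trivial]
        ring
      have hDk : ∀ k, MemLp (fun ω => D ω k) 2 P := fun k => hW.memLp_increment _ _ k
      simp only [hexp]
      rw [integral_finsetSum _ fun k _ =>
        (show Integrable (fun ω => M ω * S.val m ω k * D ω k) P from
          (hMv k).integrable_mul (hDk k))]
      refine Finset.sum_eq_zero fun k _ => ?_
      have hYm : Measurable[ℱ (S.time m)] fun ω => M ω * S.val m ω k :=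
        hMm.mul ((measurable_pi_apply k).comp
          ((WithLp.measurable_ofLp 2 _).comp (S.val_measurable m)))
      have hind : IndepFun (fun ω => M ω * S.val m ω k) (fun ω => D ω k) P :=
        hW.indepFun_increment hle hYm (φ := fun x : E d => x k)
          ((measurable_pi_apply k).comp (WithLp.measurable_ofLp 2 _))
      have := hind.integral_mul_eq_mul_integral (hMv k).aestronglyMeasurable
        (hDk k).aestronglyMeasurable
      simp only [Pi.mul_apply] at this
      rw [this]
      have h0 : ∫ ω, D ω k ∂P = 0 := hW.integral_increment _ _ k
      rw [h0, mul_zero]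
    have hvD : IndepFun (fun ω => ‖S.val m ω‖ ^ 2) (fun ω => ‖D ω‖ ^ 2) P :=
      hW.indepFun_increment hle (hnsq.comp (S.val_measurable m))
        (φ := fun x : E d => ‖x‖ ^ 2) hnsq
    have hD2 : Integrable (fun ω => ‖D ω‖ ^ 2) P := hDL.integrable_norm_pow (by norm_num)
    have hsq : ∫ ω, (inner ℝ (S.val m ω) (D ω)) ^ 2 ∂P ≤
        d * ∫ ω, ‖S.val m ω‖ ^ 2 * ((S.time (m + 1) : ℝ) - S.time m) ∂P := by
      have h1 : ∫ ω, (inner ℝ (S.val m ω) (D ω)) ^ 2 ∂P ≤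
          ∫ ω, ‖S.val m ω‖ ^ 2 * ‖D ω‖ ^ 2 ∂P := by
        refine integral_mono hincL.integrable_sq (hvD.integrable_mul (hv2 m) hD2) fun ω => ?_
        simp only
        rw [← mul_pow, ← sq_abs]
        exact pow_le_pow_left₀ (abs_nonneg _) (abs_real_inner_le_norm _ _) 2
      have h2 := hvD.integral_mul_eq_mul_integral (hv2 m).aestronglyMeasurable
        hD2.aestronglyMeasurable
      simp only [Pi.mul_apply] at h2
      rw [h2, hW.integral_norm_increment_sq hle] at h1
      rw [integral_mul_const]
      linarith
    simp only [Finset.sum_range_succ]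
    refine ⟨ihL.add hincL, ?_⟩
    have hexp : ∀ ω, (M ω + inner ℝ (S.val m ω) (D ω)) ^ 2 =
        M ω ^ 2 + 2 * (M ω * inner ℝ (S.val m ω) (D ω)) + inner ℝ (S.val m ω) (D ω) ^ 2 :=
      fun ω => by ring
    change ∫ ω, (M ω + inner ℝ (S.val m ω) (D ω)) ^ 2 ∂P ≤ _
    simp only [hexp]
    have hi1 : Integrable (fun ω => 2 * (M ω * inner ℝ (S.val m ω) (D ω))) P :=
      (ihL.integrable_mul hincL).const_mul 2
    rw [integral_add (show Integrable (fun ω => M ω ^ 2 + 2 * (M ω * inner ℝ (S.val m ω) (D ω))) P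
      from ihL.integrable_sq.add hi1) hincL.integrable_sq,
      integral_add ihL.integrable_sq hi1, integral_const_mul, hcross,
      integral_add (integrable_finsetSum _ fun i _ => (hv2 i).mul_const _)
        ((hv2 m).mul_const _)]
    rw [mul_add]
    linarith

/-- A Lenglart inequality: stopping the integrand just before its quadratic variation reaches `δ`
changes nothing where the total stays below `δ`, and there Chebyshev's inequality applies. -/
lemma measure_integral_ge_le [IsProbabilityMeasure P] (S : SimpleIntegrand ℱ T d)
    (hW : IsBrownianMotion ℱ P W)
    {ε δ : ℝ} (hε : 0 < ε) (hδ : 0 < δ) :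
    P {ω | ENNReal.ofReal ε ≤ ‖S.integral W ω‖ₑ} ≤
      P {ω | ENNReal.ofReal δ ≤ ∫⁻ t in Set.Ioc (0 : ℝ) T, ‖S.eval t.toNNReal ω‖ₑ ^ 2} +
        ENNReal.ofReal (d * δ / ε ^ 2) := by
  classical
  set A : ℕ → Ω → ℝ := fun m ω => ∑ i ∈ Finset.range m,
    ‖S.val i ω‖ ^ 2 * ((S.time (i + 1) : ℝ) - S.time i) with hA
  have hΔ : ∀ i, (0 : ℝ) ≤ (S.time (i + 1) : ℝ) - S.time i := fun i =>
    sub_nonneg.2 (by exact_mod_cast S.time_mono (Nat.le_succ i))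
  have hAmono : ∀ ω, Monotone fun m => A m ω := fun ω => monotone_nat_of_le_succ fun m => by
    simp only [hA, Finset.sum_range_succ]
    have := mul_nonneg (sq_nonneg ‖S.val m ω‖) (hΔ m)
    linarith
  have hnsq : Measurable fun x : E d => ‖x‖ ^ 2 := by fun_prop
  have hAm : ∀ m, Measurable[ℱ (S.time m)] (A (m + 1)) := fun m => by
    refine Finset.measurable_fun_sum _ fun i hi => ?_
    have him : i ≤ m := Nat.lt_succ_iff.1 (Finset.mem_range.1 hi)
    exact (hnsq.comp ((S.val_measurable i).mono (ℱ.mono (S.time_mono him)) le_rfl)).mul_const _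
  obtain ⟨C, hC⟩ := S.val_bounded
  let R : SimpleIntegrand ℱ T d :=
    { n := S.n
      time := S.time
      time_mono := S.time_mono
      time_le := S.time_le
      val := fun i => {ω | A (i + 1) ω < δ}.indicator (S.val i)
      val_measurable := fun i =>
        (S.val_measurable i).indicator (measurableSet_lt (hAm i) measurable_const)
      val_bounded := ⟨C, fun i ω => (norm_indicator_le_norm_self _ _).trans (hC i ω)⟩ }
  have hRle : ∀ ω m, ∑ i ∈ Finset.range m,
      ‖R.val i ω‖ ^ 2 * ((R.time (i + 1) : ℝ) - R.time i) ≤ min (A m ω) δ := by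
    intro ω m
    induction m with
    | zero => simp [hA, hδ.le]
    | succ m ih =>
      rw [Finset.sum_range_succ]
      by_cases h : A (m + 1) ω < δ
      · have hval : R.val m ω = S.val m ω := Set.indicator_of_mem (s := {ω | A (m + 1) ω < δ}) h _
        rw [min_eq_left h.le, hval]
        have hAs : A (m + 1) ω =
            A m ω + ‖S.val m ω‖ ^ 2 * ((S.time (m + 1) : ℝ) - S.time m) :=
          Finset.sum_range_succ _ _
        rw [hAs]
        exact add_le_add (ih.trans (min_le_left _ _)) le_rfl
      · have hval : R.val m ω = 0 := Set.indicator_of_notMem (s := {ω | A (m + 1) ω < δ}) h _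
        rw [hval]
        simp only [norm_zero, ne_eq, OfNat.ofNat_ne_zero, not_false_eq_true, zero_pow, zero_mul,
          add_zero]
        exact ih.trans (min_le_min_right _ (hAmono ω (Nat.le_succ m)))
  obtain ⟨hL, hI⟩ := R.integral_sq_le hW R.n
  have hI' : ∫ ω, (R.integral W ω) ^ 2 ∂P ≤ d * δ := by
    refine hI.trans (mul_le_mul_of_nonneg_left ?_ (Nat.cast_nonneg d))
    have : ∫ _ω, δ ∂P = δ := by simp
    rw [← this]
    refine integral_mono_of_nonneg (ae_of_all _ fun ω => Finset.sum_nonneg fun i _ =>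
      mul_nonneg (sq_nonneg _) (hΔ i)) (integrable_const _) (ae_of_all _ fun ω =>
        (hRle ω R.n).trans (min_le_right _ _))
  have hcheb : P {ω | ε ^ 2 ≤ (R.integral W ω) ^ 2} ≤ ENNReal.ofReal (d * δ / ε ^ 2) := by
    have h := mul_meas_ge_le_integral_of_nonneg (μ := P)
      (f := fun ω => (R.integral W ω) ^ 2) (ae_of_all _ fun ω => sq_nonneg _)
      hL.integrable_sq (ε ^ 2)
    rw [← ENNReal.ofReal_toReal (measure_ne_top P {ω | ε ^ 2 ≤ (R.integral W ω) ^ 2})]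
    refine ENNReal.ofReal_le_ofReal ?_
    rw [le_div_iff₀ (by positivity), mul_comm]
    exact h.trans hI'
  refine le_trans (measure_mono ?_)
    ((measure_union_le {ω | ENNReal.ofReal δ ≤ ∫⁻ t in Set.Ioc (0 : ℝ) T,
      ‖S.eval t.toNNReal ω‖ₑ ^ 2} {ω | ε ^ 2 ≤ (R.integral W ω) ^ 2}).trans
      (add_le_add le_rfl hcheb))
  intro ω hω
  by_cases h : A S.n ω < δ
  · right
    have hSR : S.integral W ω = R.integral W ω := by
      refine Finset.sum_congr rfl fun i hi => ?_
      have hi' : A (i + 1) ω < δ :=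
        (hAmono ω (Nat.succ_le_of_lt (Finset.mem_range.1 hi))).trans_lt h
      have hval : R.val i ω = S.val i ω := Set.indicator_of_mem (s := {ω | A (i + 1) ω < δ}) hi' _
      rw [hval]
    simp only [Set.mem_ofPred_eq] at hω ⊢
    rw [hSR, ← ofReal_norm, ENNReal.ofReal_le_ofReal_iff (norm_nonneg _), Real.norm_eq_abs] at hω
    rw [← sq_abs (R.integral W ω)]
    exact pow_le_pow_left₀ hε.le hω 2
  · left
    refine le_trans ?_ (S.sum_sq_le_lintegral ω)
    refine (ENNReal.ofReal_le_ofReal (not_lt.1 h)).trans (le_of_eq ?_)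
    rw [hA, ENNReal.ofReal_sum_of_nonneg fun i _ => mul_nonneg (sq_nonneg _) (hΔ i)]
    refine Finset.sum_congr rfl fun i _ => ?_
    rw [ENNReal.ofReal_mul (sq_nonneg _), ENNReal.ofReal_pow (norm_nonneg _), ofReal_norm,
      ← NNReal.coe_sub (S.time_mono (Nat.le_succ i)), ENNReal.ofReal_coe_nnreal]

/-- Integrals of simple processes tend to zero in probability with their `L²(0, T)` norms. -/
lemma tendsto_integral_zero [IsProbabilityMeasure P] {S : ℕ → SimpleIntegrand ℱ T d}
    (hW : IsBrownianMotion ℱ P W) (h : TendstoZeroInProb P fun n ω =>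
      ∫⁻ t in Set.Ioc (0 : ℝ) T, ‖(S n).eval t.toNNReal ω‖ₑ ^ 2) :
    TendstoZeroInProb P fun n ω => ‖(S n).integral W ω‖ₑ := by
  have main : ∀ ε : ℝ, 0 < ε → Tendsto
      (fun n => P {ω | ENNReal.ofReal ε ≤ ‖(S n).integral W ω‖ₑ}) atTop (𝓝 0) := by
    intro ε hε
    rw [ENNReal.tendsto_nhds_zero]
    intro η hη
    have hlim : Tendsto (fun δ : ℝ => ENNReal.ofReal (d * δ / ε ^ 2)) (𝓝[>] 0) (𝓝 0) := by
      have hc : Continuous fun δ : ℝ => ENNReal.ofReal (d * δ / ε ^ 2) := by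
        refine ENNReal.continuous_ofReal.comp ?_
        fun_prop
      have := hc.tendsto 0
      simp only [mul_zero, zero_div, ENNReal.ofReal_zero] at this
      exact this.mono_left nhdsWithin_le_nhds
    have hη2 : 0 < η / 2 := ENNReal.half_pos hη.ne'
    obtain ⟨δ, hδη, hδ⟩ :=
      ((hlim.eventually (ge_mem_nhds hη2)).and self_mem_nhdsWithin).exists
    have hδ0 : 0 < δ := hδ
    filter_upwards [(h (ENNReal.ofReal δ) (ENNReal.ofReal_pos.2 hδ0)).eventually
      (ge_mem_nhds hη2)] with n hn
    refine ((S n).measure_integral_ge_le hW hε hδ0).trans ((add_le_add hn hδη).trans ?_)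
    rw [ENNReal.add_halves]
  intro ε hε
  have hm : 0 < min ε 1 := lt_min hε one_pos
  have hmt : min ε 1 ≠ ∞ := ne_top_of_le_ne_top ENNReal.one_ne_top (min_le_right _ _)
  refine tendsto_of_tendsto_of_tendsto_of_le_of_le tendsto_const_nhds
    (main (min ε 1).toReal (ENNReal.toReal_pos hm.ne' hmt)) (fun _ => zero_le) fun n =>
      measure_mono fun ω hω => ?_
  simp only [Set.mem_ofPred_eq, ENNReal.ofReal_toReal hmt] at hω ⊢
  exact (min_le_left _ _).trans hω

end SimpleIntegrand

/-! ### The Itô integral: linearity, continuity, removal of the drift -/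

/-- `∫₀ᵀ ‖f_t‖² dt` as an element of `[0, ∞]`. -/
def l2sq {d : ℕ} (T : ℝ≥0) (f : ℝ≥0 → E d) : ℝ≥0∞ :=
  ∫⁻ t in Set.Ioc (0 : ℝ) T, ‖f t.toNNReal‖ₑ ^ 2

section L2

variable {d : ℕ} {T : ℝ≥0} {f g : ℝ≥0 → E d}

lemma enorm_add_sq_le {F : Type*} [SeminormedAddCommGroup F] (x y : F) :
    ‖x + y‖ₑ ^ 2 ≤ 2 * ‖x‖ₑ ^ 2 + 2 * ‖y‖ₑ ^ 2 := by
  have h : ‖x + y‖ ^ 2 ≤ 2 * ‖x‖ ^ 2 + 2 * ‖y‖ ^ 2 := by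
    have h1 := pow_le_pow_left₀ (norm_nonneg _) (norm_add_le x y) 2
    nlinarith [sq_nonneg (‖x‖ - ‖y‖)]
  have h2 := ENNReal.ofReal_le_ofReal h
  rw [ENNReal.ofReal_add (by positivity) (by positivity), ENNReal.ofReal_mul (by norm_num),
    ENNReal.ofReal_mul (by norm_num)] at h2
  simpa [ENNReal.ofReal_pow, ofReal_norm] using h2

lemma l2sq_add_le (hf : Measurable f) :
    l2sq T (fun t => f t + g t) ≤ 2 * l2sq T f + 2 * l2sq T g := by
  have hm : Measurable fun t : ℝ => ‖f t.toNNReal‖ₑ ^ 2 :=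
    (hf.comp measurable_real_toNNReal).enorm.pow_const 2
  calc l2sq T (fun t => f t + g t)
      ≤ ∫⁻ t in Set.Ioc (0 : ℝ) T, (2 * ‖f t.toNNReal‖ₑ ^ 2 + 2 * ‖g t.toNNReal‖ₑ ^ 2) :=
        lintegral_mono fun t => enorm_add_sq_le _ _
    _ = 2 * l2sq T f + 2 * l2sq T g := by
        rw [lintegral_add_left (hm.const_mul 2), lintegral_const_mul _ hm,
          lintegral_const_mul' _ _ (by simp)]
        rfl

lemma l2sq_const_smul (c : ℝ) : l2sq T (fun t => c • f t) = ‖c‖ₑ ^ 2 * l2sq T f := by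
  unfold l2sq
  simp only [enorm_smul, mul_pow]
  exact lintegral_const_mul' _ _ (by finiteness)

lemma lintegral_enorm_le_l2sq (hf : Measurable f) :
    ∫⁻ t in Set.Ioc (0 : ℝ) T, ‖f t.toNNReal‖ₑ ≤
      l2sq T f ^ (1 / 2 : ℝ) * (T : ℝ≥0∞) ^ (1 / 2 : ℝ) := by
  have h := ENNReal.lintegral_mul_le_Lp_mul_Lq (volume.restrict (Set.Ioc (0 : ℝ) T))
    Real.HolderConjugate.two_two (hf.comp measurable_real_toNNReal).enorm.aemeasurable
    (aemeasurable_const (b := (1 : ℝ≥0∞)))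
  simpa [l2sq, ENNReal.rpow_two] using h

end L2

namespace SimpleIntegrand

variable {Ω : Type*} {mΩ : MeasurableSpace Ω} {P : Measure Ω} {ℱ : Filtration ℝ≥0 mΩ}
  {T : ℝ≥0} {d : ℕ}

lemma measurable_l2sq_eval (S : SimpleIntegrand ℱ T d) :
    Measurable fun ω => l2sq T fun t => S.eval t ω := by
  have h : Measurable fun q : Ω × ℝ => S.eval q.2.toNNReal q.1 := by
    unfold eval
    refine Finset.measurable_fun_sum _ fun i _ => ?_
    have : (fun q : Ω × ℝ => (Set.Ioc (S.time i) (S.time (i + 1))).indicator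
        (fun _ => S.val i q.1) q.2.toNNReal) =
        ((fun q : Ω × ℝ => q.2.toNNReal) ⁻¹' Set.Ioc (S.time i) (S.time (i + 1))).indicator
          (fun q => S.val i q.1) := by
      ext1 q
      simp [Set.indicator]
    rw [this]
    exact (((S.val_measurable i).mono (ℱ.le _) le_rfl).comp measurable_fst).indicator
      ((measurable_real_toNNReal.comp measurable_snd) measurableSet_Ioc)
  exact (h.enorm.pow_const 2).lintegral_prod_right'

/-- The elementary integrals against `X_t = X_0 - ∫₀ᵗ a_u du + W_t` and against `W` differ by the
integral of the process against the drift. -/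
lemma integral_eq_of_drift (S : SimpleIntegrand ℱ T d) {W X : ℝ≥0 → Ω → E d} {ω : Ω}
    {a : ℝ≥0 → E d} (ha : Continuous a)
    (h : ∀ t : ℝ≥0, X t ω = X 0 ω - (∫ u in (0 : ℝ)..t, a u.toNNReal) + W t ω) :
    S.integral W ω = S.integral X ω +
      ∫ u in Set.Ioc (0 : ℝ) T, inner ℝ (S.eval u.toNNReal ω) (a u.toNNReal) := by
  have hac : Continuous fun u : ℝ => a u.toNNReal := ha.comp continuous_real_toNNReal
  have hai : ∀ s t : ℝ, IntegrableOn (fun u : ℝ => a u.toNNReal) (Set.Ioc s t) := fun s t =>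
    (hac.integrableOn_Icc).mono_set Set.Ioc_subset_Icc_self
  have hev : ∀ u : ℝ, inner ℝ (S.eval u.toNNReal ω) (a u.toNNReal) =
      ∑ i ∈ Finset.range S.n, (Set.Ioc (S.time i : ℝ) (S.time (i + 1))).indicator
        (fun u : ℝ => inner ℝ (S.val i ω) (a u.toNNReal)) u := by
    intro u
    unfold eval
    rw [sum_inner]
    refine Finset.sum_congr rfl fun i _ => ?_
    by_cases hu : u ∈ Set.Ioc (S.time i : ℝ) (S.time (i + 1))
    · have hu' : u.toNNReal ∈ Set.Ioc (S.time i) (S.time (i + 1)) :=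
        ⟨Real.lt_toNNReal_iff_coe_lt.2 hu.1, Real.toNNReal_le_iff_le_coe.2 hu.2⟩
      rw [Set.indicator_of_mem hu, Set.indicator_of_mem hu']
    · have hu' : u.toNNReal ∉ Set.Ioc (S.time i) (S.time (i + 1)) := fun h' =>
        hu ⟨Real.lt_toNNReal_iff_coe_lt.1 h'.1, Real.toNNReal_le_iff_le_coe.1 h'.2⟩
      rw [Set.indicator_of_notMem hu, Set.indicator_of_notMem hu', inner_zero_left]
  have hii : ∀ i, IntegrableOn (fun u : ℝ => inner ℝ (S.val i ω) (a u.toNNReal))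
      (Set.Ioc (S.time i : ℝ) (S.time (i + 1))) := fun i => (hai _ _).const_inner _
  simp only [hev]
  rw [integral_finsetSum]
  · unfold integral
    rw [← Finset.sum_add_distrib]
    refine Finset.sum_congr rfl fun i _ => ?_
    have hle : (S.time i : ℝ) ≤ S.time (i + 1) := by exact_mod_cast S.time_mono (Nat.le_succ i)
    have hsub : Set.Ioc (S.time i : ℝ) (S.time (i + 1)) ⊆ Set.Ioc (0 : ℝ) T :=
      Set.Ioc_subset_Ioc (by positivity) (by exact_mod_cast S.time_le (i + 1))
    rw [setIntegral_indicator measurableSet_Ioc, Set.inter_eq_self_of_subset_right hsub,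
      integral_inner (hai _ _), ← inner_add_right, ← intervalIntegral.integral_of_le hle,
      ← intervalIntegral.integral_interval_sub_left (hac.intervalIntegrable 0 _)
        (hac.intervalIntegrable 0 _), h (S.time (i + 1)), h (S.time i)]
    congr 1
    abel
  · intro i _
    exact ((hii i).integrable_indicator measurableSet_Ioc).restrict

end SimpleIntegrand

namespace IsItoIntegral

variable {Ω : Type*} {mΩ : MeasurableSpace Ω} {P : Measure Ω} {ℱ : Filtration ℝ≥0 mΩ}
  {T : ℝ≥0} {d : ℕ} {Z H H' : ℝ≥0 → Ω → E d} {I I' : Ω → ℝ}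

lemma exists_tendstoZeroInProb (h : IsItoIntegral ℱ P T Z H I) :
    ∃ S : ℕ → SimpleIntegrand ℱ T d,
      (TendstoZeroInProb P fun n ω => l2sq T fun t => (S n).eval t ω - H t ω) ∧
      TendstoZeroInProb P fun n ω => edist ((S n).integral Z ω) (I ω) := h

lemma of_tendstoZeroInProb (S : ℕ → SimpleIntegrand ℱ T d)
    (h1 : TendstoZeroInProb P fun n ω => l2sq T fun t => (S n).eval t ω - H t ω)
    (h2 : TendstoZeroInProb P fun n ω => edist ((S n).integral Z ω) (I ω)) :
    IsItoIntegral ℱ P T Z H I := ⟨S, h1, h2⟩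

lemma add (h : IsItoIntegral ℱ P T Z H I) (h' : IsItoIntegral ℱ P T Z H' I')
    (hm : ∀ᵐ ω ∂P, Measurable fun t => H t ω) :
    IsItoIntegral ℱ P T Z (fun t ω => H t ω + H' t ω) (fun ω => I ω + I' ω) := by
  obtain ⟨S, hS1, hS2⟩ := h.exists_tendstoZeroInProb
  obtain ⟨S', hS'1, hS'2⟩ := h'.exists_tendstoZeroInProb
  choose R hR1 hR2 using fun n => (S n).exists_add (S' n)
  refine of_tendstoZeroInProb R ?_ ?_
  · refine ((hS1.const_mul (c := 2) (by simp)).add (hS'1.const_mul (c := 2) (by simp))).mono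
      fun n => ?_
    filter_upwards [hm] with ω hω
    simp only [hR1, add_sub_add_comm]
    exact l2sq_add_le (((S n).measurable_eval_left ω).sub hω)
  · refine (hS2.add hS'2).mono fun n => ae_of_all _ fun ω => ?_
    simp only [hR2]
    exact edist_add_add_le _ _ _ _

lemma const_smul (h : IsItoIntegral ℱ P T Z H I) (c : ℝ) :
    IsItoIntegral ℱ P T Z (fun t ω => c • H t ω) (fun ω => c * I ω) := by
  obtain ⟨S, hS1, hS2⟩ := h.exists_tendstoZeroInProb
  choose R hR1 hR2 using fun n => (S n).exists_smul c
  refine of_tendstoZeroInProb R ?_ ?_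
  · refine (hS1.const_mul (c := ‖c‖ₑ ^ 2) (by finiteness)).mono fun n => ae_of_all _ fun ω => ?_
    simp only [hR1, ← smul_sub, l2sq_const_smul, le_refl]
  · refine (hS2.const_mul (c := ‖c‖ₑ) (by finiteness)).mono fun n => ae_of_all _ fun ω => ?_
    simp only [hR2, edist_eq_enorm_sub, ← mul_sub, enorm_mul, le_refl]

lemma zero : IsItoIntegral ℱ P T Z (fun _ _ => 0) (fun _ => 0) := by
  refine of_tendstoZeroInProb (fun _ => SimpleIntegrand.zero ℱ T d) ?_ ?_ <;>
  · intro ε hε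
    simp [SimpleIntegrand.zero, SimpleIntegrand.eval, SimpleIntegrand.integral, l2sq, hε.ne']

lemma sum {ι : Type*} (s : Finset ι) {H : ι → ℝ≥0 → Ω → E d} {I : ι → Ω → ℝ}
    (h : ∀ i ∈ s, IsItoIntegral ℱ P T Z (H i) (I i))
    (hm : ∀ i ∈ s, ∀ᵐ ω ∂P, Measurable fun t => H i t ω) :
    IsItoIntegral ℱ P T Z (fun t ω => ∑ i ∈ s, H i t ω) (fun ω => ∑ i ∈ s, I i ω) := by
  classical
  induction s using Finset.induction_on with
  | empty => simpa using zero
  | insert i s hi ih =>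
    simp only [Finset.sum_insert hi]
    exact (h i (Finset.mem_insert_self i s)).add
      (ih (fun j hj => h j (Finset.mem_insert_of_mem hj))
        fun j hj => hm j (Finset.mem_insert_of_mem hj)) (hm i (Finset.mem_insert_self i s))

/-- Continuity of the Brownian integral along a subsequence. The integrands need not be jointly
measurable: each is replaced by a simple process that is close outside a set of probability
`2⁻ⁿ`, and only for the simple processes is almost sure convergence turned into convergence in
probability. -/
lemma exists_seq_ae_tendsto_zero [IsProbabilityMeasure P] {W : ℝ≥0 → Ω → E d}
    (hW : IsBrownianMotion ℱ P W) {H : ℕ → ℝ≥0 → Ω → E d} {I : ℕ → Ω → ℝ}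
    (h : ∀ n, IsItoIntegral ℱ P T W (H n) (I n))
    (hm : ∀ n, ∀ᵐ ω ∂P, Measurable fun t => H n t ω)
    (h0 : ∀ᵐ ω ∂P, Tendsto (fun n => l2sq T fun t => H n t ω) atTop (𝓝 0)) :
    ∃ ns : ℕ → ℕ, StrictMono ns ∧ ∀ᵐ ω ∂P, Tendsto (fun n => I (ns n) ω) atTop (𝓝 0) := by
  have hex : ∀ n : ℕ, ∃ R : SimpleIntegrand ℱ T d,
      P {ω | ((n : ℝ≥0∞) + 1)⁻¹ ≤ l2sq T fun t => R.eval t ω - H n t ω} ≤ (2⁻¹ : ℝ≥0∞) ^ n ∧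
      P {ω | ((n : ℝ≥0∞) + 1)⁻¹ ≤ edist (R.integral W ω) (I n ω)} ≤ (2⁻¹ : ℝ≥0∞) ^ n := by
    intro n
    obtain ⟨S, hS1, hS2⟩ := (h n).exists_tendstoZeroInProb
    have hpos : (0 : ℝ≥0∞) < 2⁻¹ ^ n := ENNReal.pow_pos (by simp) n
    obtain ⟨N, hN⟩ := hS1.exists_lt (inv_nat_add_one_pos n) hpos
    obtain ⟨N', hN'⟩ := hS2.exists_lt (inv_nat_add_one_pos n) hpos
    exact ⟨S (max N N'), (hN _ (le_max_left _ _)).le, (hN' _ (le_max_right _ _)).le⟩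
  choose R hR1 hR2 using hex
  have hR0 : ∀ᵐ ω ∂P, Tendsto (fun n => l2sq T fun t => (R n).eval t ω) atTop (𝓝 0) := by
    filter_upwards [ae_tendsto_zero_of_measure_le hR1, h0, ae_all_iff.2 hm] with ω h1 h2 h3
    have hlim := (ENNReal.Tendsto.const_mul h1 (a := 2) (Or.inr (by simp))).add
      (ENNReal.Tendsto.const_mul h2 (a := 2) (Or.inr (by simp)))
    simp only [mul_zero, add_zero] at hlim
    refine tendsto_of_tendsto_of_tendsto_of_le_of_le tendsto_const_nhds hlim
      (fun _ => zero_le) fun n => ?_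
    have := l2sq_add_le (T := T) (f := fun t => (R n).eval t ω - H n t ω)
      (g := fun t => H n t ω) (((R n).measurable_eval_left ω).sub (h3 n))
    simpa using this
  have hRp := SimpleIntegrand.tendsto_integral_zero hW
    (tendstoZeroInProb_of_ae (fun n => (R n).measurable_l2sq_eval.aemeasurable) hR0)
  obtain ⟨ns, hns, hlim⟩ := hRp.exists_seq_ae
  refine ⟨ns, hns, ?_⟩
  filter_upwards [hlim, ae_tendsto_zero_of_measure_le hR2] with ω h1 h2
  rw [tendsto_iff_edist_tendsto_0]
  have h3 := (h2.comp hns.tendsto_atTop).add h1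
  rw [add_zero] at h3
  refine tendsto_of_tendsto_of_tendsto_of_le_of_le tendsto_const_nhds h3
    (fun _ => zero_le) fun n => ?_
  have := edist_triangle (I (ns n) ω) ((R (ns n)).integral W ω) 0
  rw [edist_comm (I (ns n) ω) ((R (ns n)).integral W ω), edist_zero_right,
    edist_zero_right] at this
  rw [edist_zero_right]
  exact this

/-- Passing from `dX` to `dW`: if `dX = -a(X) dt + dW` and `I = ∫₀ᵀ f(X)⋆ dX`, then
`I + ∫₀ᵀ f(X)⋆ a(X) dt = ∫₀ᵀ f(X)⋆ dW`. -/
lemma add_drift [IsProbabilityMeasure P] {W X : ℝ≥0 → Ω → E d} (hW : IsBrownianMotion ℱ P W)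
    {a f : E d → E d} (ha : Continuous a) (hf : Continuous f) (hX : IsSolution ℱ P a W X)
    (h : IsItoIntegral ℱ P T X (fun t ω => f (X t ω)) I) :
    IsItoIntegral ℱ P T W (fun t ω => f (X t ω)) (fun ω => I ω +
      ∫ t in (0 : ℝ)..T, inner ℝ (f (X t.toNNReal ω)) (a (X t.toNNReal ω))) := by
  obtain ⟨S, hS1, hS2⟩ := h.exists_tendstoZeroInProb
  obtain ⟨n1, hn1, hl1⟩ := hS1.exists_seq_ae
  obtain ⟨n2, hn2, hl2⟩ := (hS2.comp hn1).exists_seq_ae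
  refine ⟨fun n => S (n1 (n2 n)), hS1.comp (hn1.comp hn2), tendstoInMeasure_of_tendsto_ae
    (fun n => ((S _).measurable_integral hW).aestronglyMeasurable) ?_⟩
  filter_upwards [hl1, hl2, hX.continuous_paths, hX.eq] with ω h1 h2 hc heq
  have hac : Continuous fun t => a (X t ω) := ha.comp hc
  have hfc : Continuous fun t => f (X t ω) := hf.comp hc
  have hac' : Continuous fun t : ℝ => a (X t.toNNReal ω) := hac.comp continuous_real_toNNReal
  have hfc' : Continuous fun t : ℝ => f (X t.toNNReal ω) := hfc.comp continuous_real_toNNReal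
  simp only [(S _).integral_eq_of_drift hac heq]
  refine (tendsto_iff_edist_tendsto_0.2 h2).add ?_
  rw [intervalIntegral.integral_of_le T.coe_nonneg, tendsto_iff_edist_tendsto_0]
  obtain ⟨K, hK⟩ := (isCompact_Icc (a := (0 : ℝ)) (b := T)).exists_bound_of_continuousOn
    hac'.continuousOn
  have hlim : Tendsto (fun n => ENNReal.ofReal K *
      ((l2sq T fun t => (S (n1 (n2 n))).eval t ω - f (X t ω)) ^ (1 / 2 : ℝ) *
        (T : ℝ≥0∞) ^ (1 / 2 : ℝ))) atTop (𝓝 0) := by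
    have hl := ((ENNReal.continuous_rpow_const (y := (1 / 2 : ℝ))).tendsto 0).comp
      (h1.comp hn2.tendsto_atTop)
    rw [ENNReal.zero_rpow_of_pos (by norm_num)] at hl
    have hl' := ENNReal.Tendsto.const_mul (a := ENNReal.ofReal K)
      (ENNReal.Tendsto.mul_const (b := (T : ℝ≥0∞) ^ (1 / 2 : ℝ)) hl
        (Or.inr (by finiteness))) (Or.inr ENNReal.ofReal_ne_top)
    simpa only [zero_mul, mul_zero, Function.comp_def] using hl'
  refine tendsto_of_tendsto_of_tendsto_of_le_of_le tendsto_const_nhds hlim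
    (fun _ => zero_le) fun n => ?_
  set R := S (n1 (n2 n))
  obtain ⟨C, hC⟩ := R.eval_bounded
  have hRm : Measurable fun t : ℝ => R.eval t.toNNReal ω :=
    (R.measurable_eval_left ω).comp measurable_real_toNNReal
  have hi1 : IntegrableOn (fun t : ℝ => inner ℝ (R.eval t.toNNReal ω) (a (X t.toNNReal ω)))
      (Set.Ioc (0 : ℝ) T) := by
    refine Measure.integrableOn_of_bounded (M := C * K) (by simp)
      (hRm.inner hac'.measurable).aestronglyMeasurable ?_
    filter_upwards [ae_restrict_mem measurableSet_Ioc] with t ht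
    exact (norm_inner_le_norm _ _).trans (mul_le_mul (hC _ _)
      (hK t (Set.Ioc_subset_Icc_self ht)) (norm_nonneg _) ((norm_nonneg _).trans (hC 0 ω)))
  have hi2 : IntegrableOn (fun t : ℝ => inner ℝ (f (X t.toNNReal ω)) (a (X t.toNNReal ω)))
      (Set.Ioc (0 : ℝ) T) :=
    ((hfc'.inner hac').integrableOn_Icc).mono_set Set.Ioc_subset_Icc_self
  rw [edist_eq_enorm_sub, ← integral_sub hi1 hi2]
  refine (enorm_integral_le_lintegral_enorm _).trans ?_
  refine le_trans ?_ (mul_le_mul_right (lintegral_enorm_le_l2sq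
    ((R.measurable_eval_left ω).sub hfc.measurable)) (ENNReal.ofReal K))
  rw [← lintegral_const_mul' _ _ ENNReal.ofReal_ne_top]
  refine setLIntegral_mono' measurableSet_Ioc fun t ht => ?_
  rw [← inner_sub_left, ← ofReal_norm, ← ofReal_norm, mul_comm,
    ← ENNReal.ofReal_mul (norm_nonneg _)]
  exact ENNReal.ofReal_le_ofReal ((norm_inner_le_norm _ _).trans
    (mul_le_mul_of_nonneg_left (hK t (Set.Ioc_subset_Icc_self ht)) (norm_nonneg _)))

end IsItoIntegral

/-! ### Increments of the drift in the parameter as limits of Riemann sums -/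

lemma tendsto_left_riemann_sum {F : Type*} [NormedAddCommGroup F] [NormedSpace ℝ F]
    {f f' : ℝ → F} (hf : ∀ u ∈ Set.Icc (0 : ℝ) 1, HasDerivWithinAt f (f' u) (Set.Icc 0 1) u)
    (hc : ContinuousOn f' (Set.Icc 0 1)) :
    Tendsto (fun n : ℕ => ((n : ℝ) + 1)⁻¹ • ∑ i ∈ Finset.range (n + 1), f' (i / ((n : ℝ) + 1)))
      atTop (𝓝 (f 1 - f 0)) := by
  rw [Metric.tendsto_atTop]
  intro ε hε
  obtain ⟨δ, hδ, huc⟩ := Metric.uniformContinuousOn_iff.1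
    (isCompact_Icc.uniformContinuousOn_of_continuous hc) (ε / 2) (by positivity)
  obtain ⟨N, hN⟩ := exists_nat_one_div_lt hδ
  refine ⟨N, fun n hn => ?_⟩
  have hn0 : (0 : ℝ) < (n : ℝ) + 1 := by positivity
  have hnδ : 1 / ((n : ℝ) + 1) < δ := (one_div_le_one_div_of_le (by positivity)
    (by have : (N : ℝ) ≤ n := by exact_mod_cast hn
        linarith)).trans_lt hN
  have htel : f 1 - f 0 = ∑ i ∈ Finset.range (n + 1),
      (f (((i + 1 : ℕ) : ℝ) / ((n : ℝ) + 1)) - f ((i : ℝ) / ((n : ℝ) + 1))) := by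
    rw [Finset.sum_range_sub fun i : ℕ => f ((i : ℝ) / ((n : ℝ) + 1))]
    push_cast
    rw [div_self hn0.ne', zero_div]
  rw [htel, Finset.smul_sum, dist_eq_norm, ← Finset.sum_sub_distrib]
  have hterm : ∀ i ∈ Finset.range (n + 1), ‖((n : ℝ) + 1)⁻¹ • f' ((i : ℝ) / ((n : ℝ) + 1)) -
      (f (((i + 1 : ℕ) : ℝ) / ((n : ℝ) + 1)) - f ((i : ℝ) / ((n : ℝ) + 1)))‖ ≤
        ε / 2 * ((n : ℝ) + 1)⁻¹ := by
    intro i hi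
    have hin : (i : ℝ) + 1 ≤ (n : ℝ) + 1 := by
      have := Finset.mem_range.1 hi
      exact_mod_cast this
    set u := (i : ℝ) / ((n : ℝ) + 1) with hu
    set v := ((i + 1 : ℕ) : ℝ) / ((n : ℝ) + 1) with hv
    have huv : v - u = ((n : ℝ) + 1)⁻¹ := by
      rw [hu, hv]; push_cast; field_simp; ring
    have hu0 : 0 ≤ u := by positivity
    have hv1 : v ≤ 1 := by
      rw [hv, div_le_one hn0]; push_cast; exact hin
    have hle : u ≤ v := by
      have : 0 < ((n : ℝ) + 1)⁻¹ := by positivity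
      linarith
    have hsub : Set.Icc u v ⊆ Set.Icc 0 1 := Set.Icc_subset_Icc hu0 hv1
    have hmv := (convex_Icc u v).norm_image_sub_le_of_norm_hasDerivWithin_le
      (f := fun w => f w - w • f' u) (f' := fun w => f' w - f' u) (C := ε / 2) (x := u) (y := v)
      (fun w hw => ((hf w (hsub hw)).mono hsub).sub
        (by simpa using (hasDerivWithinAt_id w (Set.Icc u v)).smul_const (f' u)))
      (fun w hw => by
        rw [← dist_eq_norm]
        refine (huc w (hsub hw) u (hsub ⟨le_rfl, hle⟩) ?_).le
        rw [Real.dist_eq, abs_of_nonneg (by linarith [hw.1])]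
        have := hw.2
        rw [one_div] at hnδ
        linarith) ⟨le_rfl, hle⟩ ⟨hle, le_rfl⟩
    rw [Real.norm_of_nonneg (by linarith), huv] at hmv
    rw [← norm_neg]
    refine le_of_eq_of_le (congrArg norm ?_) hmv
    rw [← huv, sub_smul]
    abel
  refine (norm_sum_le_of_le _ hterm).trans_lt ?_
  rw [Finset.sum_const, Finset.card_range, nsmul_eq_mul]
  push_cast
  rw [mul_comm, mul_assoc, inv_mul_cancel₀ hn0.ne', mul_one]
  linarith

section Drift

variable {p d : ℕ} {Θ : Set (E p)} {b : E p → E d → E d}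

/-- The `i`-th of `n + 1` equidistant nodes on the segment from `ϑ` to `θ`. -/
def segNode {p : ℕ} (ϑ θ : E p) (n i : ℕ) : E p := ϑ + ((i : ℝ) / ((n : ℝ) + 1)) • (θ - ϑ)

lemma segNode_mem_segment (ϑ θ : E p) {n i : ℕ} (hi : i ∈ Finset.range (n + 1)) :
    segNode ϑ θ n i ∈ segment ℝ ϑ θ := by
  rw [segment_eq_image']
  refine ⟨_, ⟨by positivity, ?_⟩, rfl⟩
  rw [div_le_one (by positivity)]
  exact_mod_cast (Finset.mem_range.1 hi).le

lemma IsRegularDrift.continuous (hb : IsRegularDrift Θ b) {θ : E p} (hθ : θ ∈ Θ) :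
    Continuous (b θ) := (hb.locallyLipschitz θ hθ).continuous

lemma IsRegularDrift.differentiableAt (hb : IsRegularDrift Θ b) (hΘ : IsOpen Θ) {θ : E p}
    (hθ : θ ∈ Θ) (x : E d) : DifferentiableAt ℝ (fun ϑ => b ϑ x) θ :=
  ((hb.contDiffOn x).differentiableOn (by norm_num) θ hθ).differentiableAt (hΘ.mem_nhds hθ)

/-- The columns of the Jacobian are pointwise limits of difference quotients, which are
continuous in the state. -/
lemma IsRegularDrift.measurable_driftDeriv (hb : IsRegularDrift Θ b) (hΘ : IsOpen Θ) {θ : E p}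
    (hθ : θ ∈ Θ) (j : Fin p) : Measurable (driftDeriv b θ j) := by
  classical
  set e : E p := EuclideanSpace.single j 1
  have hlim0 : Tendsto (fun n : ℕ => θ + ((n : ℝ) + 1)⁻¹ • e) atTop (𝓝 θ) := by
    have h := (tendsto_one_div_add_atTop_nhds_zero_nat (𝕜 := ℝ)).smul_const e
    simp only [one_div, zero_smul] at h
    simpa using h.const_add θ
  have hev : ∀ᶠ n : ℕ in atTop, θ + ((n : ℝ) + 1)⁻¹ • e ∈ Θ := hlim0 (hΘ.mem_nhds hθ)
  refine measurable_of_tendsto_metrizable (f := fun (n : ℕ) x =>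
    if θ + ((n : ℝ) + 1)⁻¹ • e ∈ Θ then ((n : ℝ) + 1) • (b (θ + ((n : ℝ) + 1)⁻¹ • e) x - b θ x)
      else 0) (fun n => ?_) (tendsto_pi_nhds.2 fun x => ?_)
  · by_cases h : θ + ((n : ℝ) + 1)⁻¹ • e ∈ Θ
    · simp only [if_pos h]
      exact ((continuous_const (y := (n : ℝ) + 1)).smul
        ((hb.continuous h).sub (hb.continuous hθ))).measurable
    · simp only [if_neg h]
      exact measurable_const
  · have hder := ((hb.differentiableAt hΘ hθ x).hasFDerivAt.lim_real e).comp
      (tendsto_atTop_add_const_right atTop (1 : ℝ) tendsto_natCast_atTop_atTop)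
    refine hder.congr' ?_
    filter_upwards [hev] with n hn
    simp only [Function.comp_apply]
    rw [if_pos hn]

lemma IsRegularDrift.measurable_sum_driftDeriv (hb : IsRegularDrift Θ b) (hΘ : IsOpen Θ)
    {θ : E p} (hθ : θ ∈ Θ) (v : E p) :
    Measurable fun x => ∑ j, v j • driftDeriv b θ j x :=
  Finset.measurable_fun_sum _ fun j _ => (hb.measurable_driftDeriv hΘ hθ j).const_smul (v j)

lemma sum_smul_driftDeriv (b : E p → E d → E d) (θ v : E p) (x : E d) :
    ∑ j, v j • driftDeriv b θ j x = fderiv ℝ (fun ϑ => b ϑ x) θ v := by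
  have hv : v = ∑ j, v j • EuclideanSpace.single j (1 : ℝ) := by
    ext k
    simp [Finset.sum_apply, Pi.single_apply]
  conv_rhs => rw [hv]
  simp [driftDeriv, map_sum]

/-- The error of the Riemann sum for
`b_θ(x) - b_ϑ(x) = ∫₀¹ ḃ_{ϑ + u(θ - ϑ)}(x) (θ - ϑ) du` with `n + 1` nodes. -/
def driftDefect {p d : ℕ} (b : E p → E d → E d) (ϑ θ : E p) (n : ℕ) (x : E d) : E d :=
  ((n : ℝ) + 1)⁻¹ • (∑ i ∈ Finset.range (n + 1),
    ∑ j, (θ - ϑ) j • driftDeriv b (segNode ϑ θ n i) j x) + ((-1 : ℝ) • b θ x + b ϑ x)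

lemma IsRegularDrift.tendsto_driftDefect (hb : IsRegularDrift Θ b) (hΘ : IsOpen Θ)
    (hΘc : Convex ℝ Θ) {ϑ θ : E p} (hϑ : ϑ ∈ Θ) (hθ : θ ∈ Θ) (x : E d) :
    Tendsto (fun n => driftDefect b ϑ θ n x) atTop (𝓝 0) := by
  have hmem : ∀ u ∈ Set.Icc (0 : ℝ) 1, ϑ + u • (θ - ϑ) ∈ Θ := fun u hu =>
    hΘc.segment_subset hϑ hθ (by rw [segment_eq_image']; exact ⟨u, hu, rfl⟩)
  have hpath : Continuous fun u : ℝ => ϑ + u • (θ - ϑ) := by fun_prop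
  have h := tendsto_left_riemann_sum (f := fun u => b (ϑ + u • (θ - ϑ)) x)
    (f' := fun u => fderiv ℝ (fun q => b q x) (ϑ + u • (θ - ϑ)) (θ - ϑ))
    (fun u hu => by
      have h1 := (hb.differentiableAt hΘ (hmem u hu) x).hasFDerivAt
      have h2 : HasDerivAt (fun u : ℝ => ϑ + u • (θ - ϑ)) (θ - ϑ) u := by
        simpa using ((hasDerivAt_id u).smul_const (θ - ϑ)).const_add ϑ
      exact (h1.comp_hasDerivAt u h2).hasDerivWithinAt)
    (((((hb.contDiffOn x).continuousOn_fderiv_of_isOpen hΘ le_rfl).comp hpath.continuousOn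
      hmem)).clm_apply continuousOn_const)
  have h' := h.add_const ((-1 : ℝ) • b θ x + b ϑ x)
  simp only [one_smul, zero_smul, add_zero, add_sub_cancel, neg_smul] at h'
  have e : b θ x - b ϑ x + (-b θ x + b ϑ x) = 0 := by abel
  rw [e] at h'
  simpa only [driftDefect, sum_smul_driftDeriv, segNode, neg_smul, one_smul] using h'

lemma IsRegularDrift.exists_lipschitz_of_isCompact (hb : IsRegularDrift Θ b) (hΘ : IsOpen Θ)
    {K : Set (E p)} (hK : K ⊆ Θ) (hKc : IsCompact K) (hKconv : Convex ℝ K) (R : ℝ) :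
    ∃ C : ℝ, ∀ ϑ ∈ K, ∀ θ ∈ K, ∀ x, ‖x‖ ≤ R → ‖b θ x - b ϑ x‖ ≤ C * ‖θ - ϑ‖ := by
  obtain ⟨C, hC⟩ := hb.deriv_bounded K hK hKc R
  refine ⟨C, fun ϑ hϑ θ hθ x hx => ?_⟩
  exact hKconv.norm_image_sub_le_of_norm_fderiv_le
    (fun q hq => hb.differentiableAt hΘ (hK hq) x) (fun q hq => hC q hq x hx) hϑ hθ

lemma IsRegularDrift.exists_bound_driftDefect (hb : IsRegularDrift Θ b) (hΘ : IsOpen Θ)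
    (hΘc : Convex ℝ Θ) {ϑ θ : E p} (hϑ : ϑ ∈ Θ) (hθ : θ ∈ Θ) (R : ℝ) :
    ∃ C : ℝ, ∀ n x, ‖x‖ ≤ R → ‖driftDefect b ϑ θ n x‖ ≤ C := by
  have hsub : segment ℝ ϑ θ ⊆ Θ := hΘc.segment_subset hϑ hθ
  have hcomp : IsCompact (segment ℝ ϑ θ) := by
    rw [segment_eq_image']
    exact isCompact_Icc.image (by fun_prop)
  obtain ⟨C, hC⟩ := hb.deriv_bounded _ hsub hcomp R
  obtain ⟨C', hC'⟩ := hb.exists_lipschitz_of_isCompact hΘ hsub hcomp (convex_segment ϑ θ) R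
  refine ⟨C * ‖θ - ϑ‖ + C' * ‖θ - ϑ‖, fun n x hx => ?_⟩
  have hn0 : (0 : ℝ) < (n : ℝ) + 1 := by positivity
  refine (norm_add_le _ _).trans (add_le_add ?_ ?_)
  · rw [norm_smul, Real.norm_of_nonneg (by positivity), inv_mul_le_iff₀ hn0]
    refine (norm_sum_le_of_le _ (f := fun i => ∑ j, (θ - ϑ) j • driftDeriv b (segNode ϑ θ n i) j x)
      (n := fun _ => C * ‖θ - ϑ‖) fun i hi => ?_).trans ?_
    · rw [sum_smul_driftDeriv]
      exact (ContinuousLinearMap.le_opNorm _ _).trans (mul_le_mul_of_nonneg_right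
        (hC _ (segNode_mem_segment ϑ θ hi) x hx) (norm_nonneg _))
    · simp
  · have := hC' ϑ (left_mem_segment ℝ ϑ θ) θ (right_mem_segment ℝ ϑ θ) x hx
    rw [← norm_neg]
    refine le_of_eq_of_le (congrArg norm ?_) this
    rw [neg_one_smul]
    abel

lemma IsRegularDrift.measurable_driftDefect (hb : IsRegularDrift Θ b) (hΘ : IsOpen Θ)
    (hΘc : Convex ℝ Θ) {ϑ θ : E p} (hϑ : ϑ ∈ Θ) (hθ : θ ∈ Θ) (n : ℕ) :
    Measurable (driftDefect b ϑ θ n) := by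
  have h1 : Measurable fun x => ∑ i ∈ Finset.range (n + 1),
      ∑ j, (θ - ϑ) j • driftDeriv b (segNode ϑ θ n i) j x :=
    Finset.measurable_fun_sum _ fun i hi => hb.measurable_sum_driftDeriv hΘ
      (hΘc.segment_subset hϑ hθ (segNode_mem_segment ϑ θ hi)) _
  have h2 : Measurable fun x => (-1 : ℝ) • b θ x + b ϑ x :=
    ((hb.continuous hθ).measurable.const_smul (-1 : ℝ)).add (hb.continuous hϑ).measurable
  exact (h1.const_smul ((n : ℝ) + 1)⁻¹).add h2

lemma IsRegularDrift.tendsto_l2sq_driftDefect (hb : IsRegularDrift Θ b) (hΘ : IsOpen Θ)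
    (hΘc : Convex ℝ Θ) {ϑ θ : E p} (hϑ : ϑ ∈ Θ) (hθ : θ ∈ Θ) (T : ℝ≥0) {x : ℝ≥0 → E d}
    (hx : Continuous x) :
    Tendsto (fun n => l2sq T fun t => driftDefect b ϑ θ n (x t)) atTop (𝓝 0) := by
  have hx' : Continuous fun t : ℝ => x t.toNNReal := hx.comp continuous_real_toNNReal
  obtain ⟨R, hR⟩ := (isCompact_Icc (a := (0 : ℝ)) (b := T)).exists_bound_of_continuousOn
    hx'.continuousOn
  obtain ⟨C, hC⟩ := hb.exists_bound_driftDefect hΘ hΘc hϑ hθ R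
  have h := tendsto_lintegral_of_dominated_convergence
    (μ := volume.restrict (Set.Ioc (0 : ℝ) T))
    (F := fun n t => ‖driftDefect b ϑ θ n (x t.toNNReal)‖ₑ ^ 2) (f := fun _ => 0)
    (fun _ => ENNReal.ofReal C ^ 2)
    (fun n => (((hb.measurable_driftDefect hΘ hΘc hϑ hθ n).comp
      hx'.measurable).enorm.pow_const 2))
    (fun n => by
      filter_upwards [ae_restrict_mem measurableSet_Ioc] with t ht
      refine pow_le_pow_left₀ (zero_le) ?_ 2
      rw [← ofReal_norm]
      exact ENNReal.ofReal_le_ofReal (hC n _ (hR t (Set.Ioc_subset_Icc_self ht))))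
    (by
      rw [setLIntegral_const]
      exact ENNReal.mul_ne_top (by finiteness) (by simp))
    (ae_of_all _ fun t => by
      have h1 := (hb.tendsto_driftDefect hΘ hΘc hϑ hθ (x t.toNNReal)).enorm
      have h2 := ENNReal.Tendsto.pow (n := 2) h1
      simpa using h2)
  simpa [l2sq] using h

end Drift

section Increment

variable {Ω : Type*} {mΩ : MeasurableSpace Ω} {P : Measure Ω} [IsProbabilityMeasure P]
  {ℱ : Filtration ℝ≥0 mΩ} {p d : ℕ} {Θ : Set (E p)} {b : E p → E d → E d}
  {W X : ℝ≥0 → Ω → E d} {T : ℝ≥0} {J : E p → Fin p → Ω → ℝ}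

/-- The stochastic mean value inequality for two fixed parameters. Riemann sums of the gradient
field converge to the increment of `θ ↦ ∫₀ᵀ b_θ(X_t)⋆ dW_t`, and on `𝒯` each of their terms is
bounded, so no stochastic Fubini theorem and no measurability of `J` in `θ` is needed. -/
lemma ae_abs_sub_le_of_mem_gradEvent (hΘ : IsOpen Θ) (hΘc : Convex ℝ Θ)
    (hb : IsRegularDrift Θ b) (hW : IsBrownianMotion ℱ P W)
    (hXm : ∀ᵐ ω ∂P, Continuous fun t => X t ω) (hT : 0 < T)
    (hJ : ∀ θ ∈ Θ, ∀ j, IsItoIntegral ℱ P T W (fun t ω => driftDeriv b θ j (X t ω)) (J θ j))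
    (lam : ℝ) {ϑ θ : E p} (hϑ : ϑ ∈ Θ) (hθ : θ ∈ Θ) {M M' : Ω → ℝ}
    (hM : IsItoIntegral ℱ P T W (fun t ω => b θ (X t ω)) M)
    (hM' : IsItoIntegral ℱ P T W (fun t ω => b ϑ (X t ω)) M') :
    ∀ᵐ ω ∂P, ω ∈ gradEvent Θ T J lam → |M ω - M' ω| ≤ T * (lam / 2) * l1 (θ - ϑ) := by
  have hcomp : ∀ {f : E d → E d}, Measurable f → ∀ᵐ ω ∂P, Measurable fun t => f (X t ω) :=
    fun hf => hXm.mono fun ω hω => hf.comp hω.measurable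
  have hnode : ∀ n, ∀ i ∈ Finset.range (n + 1), segNode ϑ θ n i ∈ Θ := fun n i hi =>
    hΘc.segment_subset hϑ hθ (segNode_mem_segment ϑ θ hi)
  have hIto : ∀ n : ℕ, IsItoIntegral ℱ P T W (fun t ω => driftDefect b ϑ θ n (X t ω))
      (fun ω => ((n : ℝ) + 1)⁻¹ * (∑ i ∈ Finset.range (n + 1),
        ∑ j, (θ - ϑ) j * J (segNode ϑ θ n i) j ω) + (-1 * M ω + M' ω)) := by
    intro n
    have hinner : ∀ i ∈ Finset.range (n + 1), IsItoIntegral ℱ P T W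
        (fun t ω => ∑ j, (θ - ϑ) j • driftDeriv b (segNode ϑ θ n i) j (X t ω))
        (fun ω => ∑ j, (θ - ϑ) j * J (segNode ϑ θ n i) j ω) := fun i hi =>
      IsItoIntegral.sum _ (fun j _ => (hJ _ (hnode n i hi) j).const_smul ((θ - ϑ) j))
        fun j _ => hcomp ((hb.measurable_driftDeriv hΘ (hnode n i hi) j).const_smul ((θ - ϑ) j))
    have hsumm : Measurable fun x => ∑ i ∈ Finset.range (n + 1),
        ∑ j, (θ - ϑ) j • driftDeriv b (segNode ϑ θ n i) j x :=
      Finset.measurable_fun_sum _ fun i hi => hb.measurable_sum_driftDeriv hΘ (hnode n i hi) _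
    have hsum := (IsItoIntegral.sum (Finset.range (n + 1)) hinner fun i hi =>
      hcomp (hb.measurable_sum_driftDeriv hΘ (hnode n i hi) (θ - ϑ))).const_smul
        ((n : ℝ) + 1)⁻¹
    have hdiff := (hM.const_smul (-1)).add hM'
      (hcomp ((hb.continuous hθ).measurable.const_smul (-1 : ℝ)))
    exact hsum.add hdiff (hcomp (hsumm.const_smul ((n : ℝ) + 1)⁻¹))
  obtain ⟨ns, -, hlim⟩ := IsItoIntegral.exists_seq_ae_tendsto_zero hW hIto
    (fun n => hcomp (hb.measurable_driftDefect hΘ hΘc hϑ hθ n))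
    (hXm.mono fun ω hω => hb.tendsto_l2sq_driftDefect hΘ hΘc hϑ hθ T hω)
  filter_upwards [hlim] with ω hω hgrad
  have hT0 : (0 : ℝ) < T := by exact_mod_cast hT
  have hlim2 := (hω.sub_const (-1 * M ω + M' ω)).abs
  have he : |0 - (-1 * M ω + M' ω)| = |M ω - M' ω| := by
    congr 1
    ring
  rw [he] at hlim2
  refine le_of_tendsto hlim2 (Eventually.of_forall fun n => ?_)
  rw [add_sub_cancel_right, abs_mul, abs_of_nonneg (by positivity),
    inv_mul_le_iff₀ (by positivity)]
  have hterm : ∀ i ∈ Finset.range (ns n + 1),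
      |∑ j, (θ - ϑ) j * J (segNode ϑ θ (ns n) i) j ω| ≤ T * (lam / 2) * l1 (θ - ϑ) := by
    intro i hi
    refine (Finset.abs_sum_le_sum_abs _ _).trans ?_
    rw [l1, Finset.mul_sum]
    refine Finset.sum_le_sum fun j _ => ?_
    have hj := hgrad _ (hnode _ i hi) j
    rw [abs_mul, abs_of_pos (by positivity : (0 : ℝ) < 1 / T), one_div,
      inv_mul_le_iff₀ hT0] at hj
    rw [abs_mul, mul_comm]
    exact mul_le_mul_of_nonneg_right hj (abs_nonneg _)
  refine (Finset.abs_sum_le_sum_abs _ _).trans ((Finset.sum_le_sum hterm).trans ?_)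
  simp

end Increment

/-! ### From a countable parameter set to all of `Θ` -/

section Separability

variable {p d : ℕ} {Θ : Set (E p)} {b : E p → E d → E d}

/-- `θ ↦ ∫₀ᵀ b_θ(x_t)⋆ a(x_t) dt` is continuous on `Θ` along a continuous path. -/
lemma IsRegularDrift.continuousOn_integral_inner (hb : IsRegularDrift Θ b) (hΘ : IsOpen Θ)
    {a : E d → E d} (ha : Continuous a) (T : ℝ≥0) {x : ℝ≥0 → E d} (hx : Continuous x) :
    ContinuousOn (fun θ => ∫ t in (0 : ℝ)..T, inner ℝ (b θ (x t.toNNReal)) (a (x t.toNNReal)))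
      Θ := by
  intro q₀ hq₀
  have hx' : Continuous fun t : ℝ => x t.toNNReal := hx.comp continuous_real_toNNReal
  have hax : Continuous fun t : ℝ => a (x t.toNNReal) := ha.comp hx'
  have hbx : ∀ q ∈ Θ, Continuous fun t : ℝ => b q (x t.toNNReal) := fun q hq =>
    (hb.continuous hq).comp hx'
  obtain ⟨R, hR⟩ := (isCompact_Icc (a := (0 : ℝ)) (b := T)).exists_bound_of_continuousOn
    hx'.continuousOn
  obtain ⟨r, hr, hball⟩ := Metric.nhds_basis_closedBall.mem_iff.1 (hΘ.mem_nhds hq₀)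
  obtain ⟨C, hC⟩ := hb.exists_lipschitz_of_isCompact hΘ hball (isCompact_closedBall q₀ r)
    (convex_closedBall q₀ r) R
  refine intervalIntegral.continuousWithinAt_of_dominated_interval
    (bound := fun t => (‖b q₀ (x t.toNNReal)‖ + |C| * r) * ‖a (x t.toNNReal)‖) ?_ ?_ ?_ ?_
  · filter_upwards [self_mem_nhdsWithin] with q hq
    exact ((hbx q hq).inner hax).aestronglyMeasurable
  · filter_upwards [mem_nhdsWithin_of_mem_nhds (Metric.closedBall_mem_nhds q₀ hr)] with q hq
    refine ae_of_all _ fun t ht => ?_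
    rw [Set.uIoc_of_le T.coe_nonneg] at ht
    refine (norm_inner_le_norm _ _).trans (mul_le_mul_of_nonneg_right ?_ (norm_nonneg _))
    have h1 := hC q₀ (Metric.mem_closedBall_self hr.le) q hq (x t.toNNReal)
      (hR t (Set.Ioc_subset_Icc_self ht))
    have h2 : C * ‖q - q₀‖ ≤ |C| * r := by
      refine mul_le_mul (le_abs_self C) ?_ (norm_nonneg _) (abs_nonneg C)
      rw [← dist_eq_norm]
      exact hq
    have h3 := norm_le_norm_add_norm_sub' (b q (x t.toNNReal)) (b q₀ (x t.toNNReal))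
    linarith
  · exact ((((hbx q₀ hq₀).norm.add continuous_const).mul hax.norm)).intervalIntegrable _ _
  · refine ae_of_all _ fun t _ => ?_
    exact (((hb.contDiffOn (x t.toNNReal)).continuousOn) q₀ hq₀).inner
      continuousWithinAt_const

lemma continuous_l1 : Continuous (l1 : E p → ℝ) := by
  unfold l1
  fun_prop

/-- A modulus of continuity for `I + g`, with `g` continuous, extends from `D` to `Θ` when the
graph of `I` over `D` is dense in its graph over `Θ`. -/
lemma abs_sub_le_of_dense_graph {D : Set (E p)} (hD : D ⊆ Θ) {I g : E p → ℝ}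
    (hg : ContinuousOn g Θ) (hI : ∀ θ ∈ Θ, (θ, I θ) ∈ closure ((fun q => (q, I q)) '' D)) {c : ℝ}
    (h : ∀ θ ∈ D, ∀ ϑ ∈ D, |(I θ + g θ) - (I ϑ + g ϑ)| ≤ c * l1 (θ - ϑ)) :
    ∀ θ ∈ Θ, ∀ ϑ ∈ Θ, |(I θ + g θ) - (I ϑ + g ϑ)| ≤ c * l1 (θ - ϑ) := by
  have happrox : ∀ θ ∈ Θ, ∃ q : ℕ → E p, (∀ n, q n ∈ D) ∧ Tendsto q atTop (𝓝 θ) ∧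
      Tendsto (fun n => I (q n) + g (q n)) atTop (𝓝 (I θ + g θ)) := by
    intro θ hθ
    obtain ⟨u, hu, hlim⟩ := mem_closure_iff_seq_limit.1 (hI θ hθ)
    choose q hq hqu using hu
    have h1 : Tendsto q atTop (𝓝 θ) := by
      have := (continuous_fst.tendsto _).comp hlim
      refine this.congr fun n => ?_
      simp [← hqu n]
    have h2 : Tendsto (fun n => I (q n)) atTop (𝓝 (I θ)) := by
      have := (continuous_snd.tendsto _).comp hlim
      refine this.congr fun n => ?_
      simp [← hqu n]
    exact ⟨q, hq, h1, h2.add ((hg θ hθ).tendsto.comp (tendsto_nhdsWithin_iff.2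
      ⟨h1, Eventually.of_forall fun n => hD (hq n)⟩))⟩
  intro θ hθ ϑ hϑ
  obtain ⟨q, hq, hq1, hq2⟩ := happrox θ hθ
  obtain ⟨q', hq', hq1', hq2'⟩ := happrox ϑ hϑ
  exact le_of_tendsto_of_tendsto' (hq2.sub hq2').abs
    (((continuous_l1.tendsto _).comp (hq1.sub hq1')).const_mul c)
    fun n => h _ (hq n) _ (hq' n)

end Separability

/-! ### Sparsity and the cone -/

section Vectors

variable {p : ℕ}

lemma l1_nonneg (x : E p) : 0 ≤ l1 x := Finset.sum_nonneg fun _ _ => abs_nonneg _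

lemma l1_sub_l1_add_le (θ η : E p) :
    l1 θ - l1 η + l1 (η - θ) ≤ 2 * ∑ j with θ j ≠ 0, |(η - θ) j| := by
  unfold l1
  rw [Finset.sum_filter, Finset.mul_sum, ← Finset.sum_sub_distrib, ← Finset.sum_add_distrib]
  refine Finset.sum_le_sum fun j _ => ?_
  simp only [PiLp.sub_apply]
  split_ifs with h
  · have h1 := abs_sub_abs_le_abs_sub (θ j) (η j)
    rw [abs_sub_comm] at h1
    linarith
  · rw [not_not.1 h]
    simp

lemma sum_abs_le_sqrt_card_mul_norm (x : E p) (S : Finset (Fin p)) :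
    ∑ j ∈ S, |x j| ≤ √(S.card : ℝ) * ‖x‖ := by
  rw [EuclideanSpace.norm_eq, ← Real.sqrt_mul (Nat.cast_nonneg _)]
  refine Real.le_sqrt_of_sq_le ((sq_sum_le_card_mul_sum_sq (s := S)).trans ?_)
  refine mul_le_mul_of_nonneg_left ?_ (Nat.cast_nonneg _)
  simp only [Real.norm_eq_abs]
  exact Finset.sum_le_sum_of_subset_of_nonneg (Finset.subset_univ S) fun _ _ _ => sq_nonneg _

/-- A set of `s` coordinates of maximal total absolute value is a set of largest coordinates,
since otherwise an exchange of two coordinates would increase the total. -/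
lemma exists_isLargestCoords (x : E p) (S : Finset (Fin p)) :
    ∃ S', IsLargestCoords S.card x S' ∧ ∑ j ∈ S, |x j| ≤ ∑ j ∈ S', |x j| := by
  obtain ⟨S', hS', hmax⟩ := Finset.exists_max_image
    (Finset.powersetCard S.card (Finset.univ : Finset (Fin p))) (fun U => ∑ j ∈ U, |x j|)
    ⟨S, by simp⟩
  rw [Finset.mem_powersetCard] at hS'
  refine ⟨S', ⟨hS'.2, fun i hi j hj => ?_⟩, hmax S (by simp)⟩
  have hj' : j ∉ S'.erase i := fun h => hj (Finset.mem_of_mem_erase h)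
  have h := hmax (insert j (S'.erase i)) (by
    rw [Finset.mem_powersetCard]
    refine ⟨Finset.subset_univ _, ?_⟩
    rw [Finset.card_insert_of_notMem hj', Finset.card_erase_add_one hi, hS'.2])
  rw [Finset.sum_insert hj', ← Finset.add_sum_erase S' _ hi] at h
  linarith

lemma mem_cone_of_l1_le {x : E p} (hx : x ≠ 0) {S : Finset (Fin p)} {c : ℝ} (hc : 0 ≤ 1 + c)
    (h : l1 x ≤ (1 + c) * ∑ j ∈ S, |x j|) : x ∈ cone p S.card c := by
  obtain ⟨S', hS', hle⟩ := exists_isLargestCoords x S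
  exact ⟨hx, S', hS', h.trans (mul_le_mul_of_nonneg_left hle hc)⟩

end Vectors

/-! ### The likelihood as a noisy squared distance -/

section Path

variable {d : ℕ} {T : ℝ≥0} {x : ℝ≥0 → E d}

lemma pathNorm_sq (T : ℝ≥0) (x : ℝ≥0 → E d) (f : E d → E d) :
    pathNorm T x f ^ 2 = (1 / (T : ℝ)) * ∫ t in (0 : ℝ)..T, ‖f (x t.toNNReal)‖ ^ 2 := by
  have h : pathInner T x f f = (1 / (T : ℝ)) * ∫ t in (0 : ℝ)..T, ‖f (x t.toNNReal)‖ ^ 2 := by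
    simp only [pathInner, real_inner_self_eq_norm_sq]
  rw [pathNorm, Real.sq_sqrt, h]
  rw [h]
  exact mul_nonneg (by positivity)
    (intervalIntegral.integral_nonneg T.coe_nonneg fun _ _ => by positivity)

lemma pathNorm_sub_sq_le (hx : Continuous x) {f g h : E d → E d} (hf : Continuous f)
    (hg : Continuous g) (hh : Continuous h) :
    pathNorm T x (fun y => f y - g y) ^ 2 ≤ 2 * pathNorm T x (fun y => g y - h y) ^ 2 +
      2 * pathNorm T x (fun y => f y - h y) ^ 2 := by
  have hx' : Continuous fun t : ℝ => x t.toNNReal := hx.comp continuous_real_toNNReal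
  have hgh : IntervalIntegrable
      (fun t : ℝ => 2 * ‖g (x t.toNNReal) - h (x t.toNNReal)‖ ^ 2) volume 0 T :=
    Continuous.intervalIntegrable (by fun_prop) _ _
  have hfh : IntervalIntegrable
      (fun t : ℝ => 2 * ‖f (x t.toNNReal) - h (x t.toNNReal)‖ ^ 2) volume 0 T :=
    Continuous.intervalIntegrable (by fun_prop) _ _
  simp only [pathNorm_sq]
  have key : ∫ t in (0 : ℝ)..T, ‖f (x t.toNNReal) - g (x t.toNNReal)‖ ^ 2 ≤
      ∫ t in (0 : ℝ)..T, (2 * ‖g (x t.toNNReal) - h (x t.toNNReal)‖ ^ 2 +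
        2 * ‖f (x t.toNNReal) - h (x t.toNNReal)‖ ^ 2) := by
    refine intervalIntegral.integral_mono_on T.coe_nonneg
      (Continuous.intervalIntegrable (by fun_prop) _ _) (hgh.add hfh) fun t _ => ?_
    have h1 := norm_sub_le (f (x t.toNNReal) - h (x t.toNNReal))
      (g (x t.toNNReal) - h (x t.toNNReal))
    rw [sub_sub_sub_cancel_right] at h1
    have h2 := pow_le_pow_left₀ (norm_nonneg _) h1 2
    nlinarith [sq_nonneg (‖f (x t.toNNReal) - h (x t.toNNReal)‖ -
      ‖g (x t.toNNReal) - h (x t.toNNReal)‖)]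
  rw [intervalIntegral.integral_add hgh hfh, intervalIntegral.integral_const_mul,
    intervalIntegral.integral_const_mul] at key
  have := mul_le_mul_of_nonneg_left key (by positivity : (0 : ℝ) ≤ 1 / T)
  linarith

/-- Completing the square in the log-likelihood: with `M_θ = I_θ + ∫₀ᵀ b_θ(X_t)⋆ b_{θ₀}(X_t) dt`,
which is the integral of `b_θ(X)` against `W`,
`ℒ_T(θ) = M_θ / T + ½ ‖b_θ - b_{θ₀}‖_T² - ½ ‖b_{θ₀}‖_T²`. -/
lemma negLogLik_eq {Ω : Type*} {p : ℕ} {b : E p → E d → E d} {X : ℝ≥0 → Ω → E d}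
    {I : E p → Ω → ℝ} {ω : Ω} (hX : Continuous fun t => X t ω) {θ θ₀ : E p}
    (hθ : Continuous (b θ)) (hθ₀ : Continuous (b θ₀)) :
    negLogLik b X T I θ ω = (1 / (T : ℝ)) * (I θ ω +
      ∫ t in (0 : ℝ)..T, inner ℝ (b θ (X t.toNNReal ω)) (b θ₀ (X t.toNNReal ω))) +
      1 / 2 * pathNorm T (fun t => X t ω) (fun y => b θ y - b θ₀ y) ^ 2 -
      1 / (2 * (T : ℝ)) * ∫ t in (0 : ℝ)..T, ‖b θ₀ (X t.toNNReal ω)‖ ^ 2 := by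
  have hx' : Continuous fun t : ℝ => X t.toNNReal ω := hX.comp continuous_real_toNNReal
  have i1 : IntervalIntegrable (fun t : ℝ => ‖b θ (X t.toNNReal ω)‖ ^ 2) volume 0 T :=
    Continuous.intervalIntegrable (by fun_prop) _ _
  have i2 : IntervalIntegrable (fun t : ℝ =>
      2 * inner ℝ (b θ (X t.toNNReal ω)) (b θ₀ (X t.toNNReal ω))) volume 0 T :=
    Continuous.intervalIntegrable (by fun_prop) _ _
  have i3 : IntervalIntegrable (fun t : ℝ => ‖b θ₀ (X t.toNNReal ω)‖ ^ 2) volume 0 T :=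
    Continuous.intervalIntegrable (by fun_prop) _ _
  have hexp : ∀ t : ℝ, ‖b θ (X t.toNNReal ω) - b θ₀ (X t.toNNReal ω)‖ ^ 2 =
      ‖b θ (X t.toNNReal ω)‖ ^ 2 -
        2 * inner ℝ (b θ (X t.toNNReal ω)) (b θ₀ (X t.toNNReal ω)) +
        ‖b θ₀ (X t.toNNReal ω)‖ ^ 2 := fun t => norm_sub_sq_real _ _
  rw [pathNorm_sq]
  simp only [hexp]
  rw [intervalIntegral.integral_add (i1.sub i2) i3, intervalIntegral.integral_sub i1 i2,
    intervalIntegral.integral_const_mul, negLogLik]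
  ring

end Path

/-! ### The oracle inequality -/

/-- The arithmetic of the oracle inequality. The cross term is split by
`c N ≤ ε c² + N² / (4 ε)` with `c = 4 λ √s / k` and `2 ε = (γ + 2) / γ`; this `ε` is the one for
which the factor in front of `B` becomes `1 + γ`. -/
lemma oracle_arith {A B N D σ lam γ k s : ℝ} (hγ : 0 < γ) (hk : 0 < k) (hlam : 0 < lam)
    (hs : 0 ≤ s) (hAB : A ≤ B + 4 * lam * σ) (hσ : σ ≤ √s * D) (hD : k * D ≤ N)
    (hN : N ^ 2 ≤ 2 * A + 2 * B) :
    A ≤ (1 + γ) * B + 4 * ((γ + 2) ^ 2 * s * lam ^ 2) / (γ * k ^ 2) := by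
  set c : ℝ := 4 * lam * √s / k with hc
  have hcN : A ≤ B + c * N := by
    have h1 : 4 * lam * σ ≤ 4 * lam * (√s * D) := by gcongr
    have h2 : 4 * lam * (√s * D) = c * (k * D) := by
      rw [hc]; field_simp
    have h3 : c * (k * D) ≤ c * N := by
      refine mul_le_mul_of_nonneg_left hD ?_
      positivity
    linarith
  have hc2 : 4 * ((γ + 2) ^ 2 * s * lam ^ 2) / (γ * k ^ 2) = (γ + 2) ^ 2 / (4 * γ) * c ^ 2 := by
    have : c ^ 2 = 16 * lam ^ 2 * s / k ^ 2 := by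
      rw [hc, div_pow, mul_pow, Real.sq_sqrt hs]
      ring
    rw [this]
    field_simp
    ring
  rw [hc2]
  have hyoung : c * N ≤ (γ + 2) / (2 * γ) * c ^ 2 + γ / (2 * (γ + 2)) * N ^ 2 := by
    have h := sq_nonneg ((γ + 2) * c - γ * N)
    have e : (γ + 2) / (2 * γ) * c ^ 2 + γ / (2 * (γ + 2)) * N ^ 2 - c * N =
        ((γ + 2) * c - γ * N) ^ 2 / (2 * γ * (γ + 2)) := by
      field_simp
      ring
    have : 0 ≤ ((γ + 2) * c - γ * N) ^ 2 / (2 * γ * (γ + 2)) := by positivity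
    linarith
  have h4 : A ≤ B + (γ + 2) / (2 * γ) * c ^ 2 + γ / (2 * (γ + 2)) * (2 * A + 2 * B) := by
    have : γ / (2 * (γ + 2)) * N ^ 2 ≤ γ / (2 * (γ + 2)) * (2 * A + 2 * B) := by gcongr
    linarith
  have h5 := mul_le_mul_of_nonneg_left h4 (by positivity : 0 ≤ (γ + 2) / 2)
  have e : (γ + 2) / 2 * (B + (γ + 2) / (2 * γ) * c ^ 2 + γ / (2 * (γ + 2)) * (2 * A + 2 * B)) =
      (1 + γ) * B + (γ + 2) ^ 2 / (4 * γ) * c ^ 2 + γ / 2 * A := by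
    field_simp
    ring
  rw [e] at h5
  linarith

section Oracle

variable {p s : ℕ} {A B lam γ k N : ℝ} {θ η : E p}

/-- The error is in the cone as soon as `Δ ≠ 0` and `‖Δ‖₁ ≤ (4 + 4/γ) ‖Δ|_S‖₁` for the support `S`
of `θ`. -/
lemma sub_mem_cone (hγ : 0 < γ) (hs : l0 θ = s) (hne : η ≠ θ)
    (h : l1 (η - θ) ≤ (4 + 4 / γ) * ∑ j with θ j ≠ 0, |(η - θ) j|) :
    θ - η ∈ cone p s (3 + 4 / γ) := by
  have hneg : ∀ j, |(θ - η) j| = |(η - θ) j| := fun j => by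
    simp only [PiLp.sub_apply]
    exact abs_sub_comm _ _
  rw [← hs, l0]
  refine mem_cone_of_l1_le (sub_ne_zero.2 hne.symm) (by positivity) ?_
  have e : 1 + (3 + 4 / γ) = 4 + 4 / γ := by ring
  have e1 : l1 (θ - η) = l1 (η - θ) := Finset.sum_congr rfl fun j _ => hneg j
  rw [e, e1]
  simpa only [hneg] using h

/-- The oracle inequality from the basic inequality `A + λ‖Δ‖₁ ≤ B + 4λ‖Δ|_S‖₁`, where
`Δ = η - θ` and `S` is the support of `θ`. Unless the last term is at most `γ B`, the error `Δ`
lies in the cone, where the restricted eigenvalue condition applies. -/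
lemma oracle_of_basic (hγ : 0 < γ) (hk : 0 < k) (hlam : 0 < lam) (hs : l0 θ = s)
    (hA : 0 ≤ A) (hB : 0 ≤ B)
    (hbasic : A + lam * l1 (η - θ) ≤ B + 4 * lam * ∑ j with θ j ≠ 0, |(η - θ) j|)
    (heig : θ - η ∈ cone p s (3 + 4 / γ) → k * ‖η - θ‖ ≤ N) (hN : N ^ 2 ≤ 2 * A + 2 * B) :
    A ≤ (1 + γ) * B + 4 * ((γ + 2) ^ 2 * (s : ℝ) * lam ^ 2) / (γ * k ^ 2) := by
  set σ := ∑ j with θ j ≠ 0, |(η - θ) j| with hσ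
  have hL := mul_nonneg hlam.le (l1_nonneg (η - θ))
  rcases le_or_gt (4 * lam * σ) (γ * B) with h | h
  · have : 0 ≤ 4 * ((γ + 2) ^ 2 * (s : ℝ) * lam ^ 2) / (γ * k ^ 2) := by positivity
    linarith
  · have hσpos : 0 < σ := by
      have h1 : 0 < 4 * lam * σ := (mul_nonneg hγ.le hB).trans_lt h
      exact pos_of_mul_pos_right h1 (by positivity)
    have hne : η ≠ θ := by
      rintro rfl
      simp [hσ] at hσpos
    have hcone : θ - η ∈ cone p s (3 + 4 / γ) := by
      refine sub_mem_cone hγ hs hne ?_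
      have hB' : B ≤ 4 * lam * σ / γ := by
        rw [le_div_iff₀ hγ]
        linarith
      have h2 : lam * l1 (η - θ) ≤ lam * ((4 + 4 / γ) * σ) := by
        have e : lam * ((4 + 4 / γ) * σ) = 4 * lam * σ / γ + 4 * lam * σ := by
          field_simp
          ring
        linarith
      exact le_of_mul_le_mul_left h2 hlam
    have hσle : σ ≤ √(s : ℝ) * ‖η - θ‖ := by
      have := sum_abs_le_sqrt_card_mul_norm (η - θ) (Finset.univ.filter fun j => θ j ≠ 0)
      rw [← hs]
      exact this
    exact oracle_arith hγ hk hlam (Nat.cast_nonneg s) (by linarith) hσle (heig hcone) hN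

/-- The error bounds when the drift itself is the oracle, that is `B = 0`. -/
lemma error_bounds_of_basic (hγ : 0 < γ) (hk : 0 < k) (hlam : 0 < lam) (hs : l0 θ = s)
    (hN0 : 0 ≤ N)
    (hbasic : N ^ 2 + lam * l1 (η - θ) ≤ 4 * lam * ∑ j with θ j ≠ 0, |(η - θ) j|)
    (heig : θ - η ∈ cone p s (3 + 4 / γ) → k * ‖η - θ‖ ≤ N)
    (hN : N ^ 2 ≤ 4 * ((γ + 2) ^ 2 * (s : ℝ) * lam ^ 2) / (γ * k ^ 2)) :
    ‖η - θ‖ ^ 2 ≤ 4 * ((γ + 2) ^ 2 * (s : ℝ) * lam ^ 2) / (γ * k ^ 4) ∧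
    l1 (η - θ) ≤ 4 * (γ + 1) / γ * √(s : ℝ) * ‖η - θ‖ ∧
    l1 (η - θ) ≤ 8 * (γ + 1) * (γ + 2) * (s : ℝ) * lam / (γ ^ (3 / 2 : ℝ) * k ^ 2) := by
  set σ := ∑ j with θ j ≠ 0, |(η - θ) j| with hσ
  have hσ0 : 0 ≤ σ := Finset.sum_nonneg fun _ _ => abs_nonneg _
  have hL4 : l1 (η - θ) ≤ (4 + 4 / γ) * σ := by
    have h1 : lam * l1 (η - θ) ≤ lam * (4 * σ) := by nlinarith [sq_nonneg N]
    have h2 := le_of_mul_le_mul_left h1 hlam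
    have h3 : 0 ≤ 4 / γ * σ := by positivity
    linarith
  have hkN : k * ‖η - θ‖ ≤ N := by
    rcases eq_or_ne η θ with rfl | hne
    · simpa using hN0
    · exact heig (sub_mem_cone hγ hs hne hL4)
  have hσle : σ ≤ √(s : ℝ) * ‖η - θ‖ := by
    have := sum_abs_le_sqrt_card_mul_norm (η - θ) (Finset.univ.filter fun j => θ j ≠ 0)
    rw [← hs]
    exact this
  have hD2 : ‖η - θ‖ ^ 2 ≤ 4 * ((γ + 2) ^ 2 * (s : ℝ) * lam ^ 2) / (γ * k ^ 4) := by
    have h1 : (k * ‖η - θ‖) ^ 2 ≤ 4 * ((γ + 2) ^ 2 * (s : ℝ) * lam ^ 2) / (γ * k ^ 2) :=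
      (pow_le_pow_left₀ (by positivity) hkN 2).trans hN
    rw [le_div_iff₀ (by positivity)] at h1 ⊢
    calc ‖η - θ‖ ^ 2 * (γ * k ^ 4) = (k * ‖η - θ‖) ^ 2 * (γ * k ^ 2) := by ring
      _ ≤ _ := h1
  have hL2 : l1 (η - θ) ≤ 4 * (γ + 1) / γ * √(s : ℝ) * ‖η - θ‖ := by
    have e : (4 + 4 / γ) = 4 * (γ + 1) / γ := by field_simp
    rw [e] at hL4
    rw [mul_assoc]
    exact hL4.trans (mul_le_mul_of_nonneg_left hσle (by positivity))
  refine ⟨hD2, hL2, hL2.trans ?_⟩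
  have hD : ‖η - θ‖ ≤ 2 * (γ + 2) * √(s : ℝ) * lam / (√γ * k ^ 2) := by
    refine le_of_sq_le_sq (hD2.trans (le_of_eq ?_)) (by positivity)
    rw [div_pow, mul_pow, mul_pow, mul_pow, mul_pow (√γ), Real.sq_sqrt hγ.le,
      Real.sq_sqrt (Nat.cast_nonneg s)]
    ring
  have hpow : γ ^ (3 / 2 : ℝ) = γ * √γ := by
    rw [Real.sqrt_eq_rpow, ← Real.rpow_one_add' hγ.le (by norm_num)]
    norm_num
  calc 4 * (γ + 1) / γ * √(s : ℝ) * ‖η - θ‖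
      ≤ 4 * (γ + 1) / γ * √(s : ℝ) * (2 * (γ + 2) * √(s : ℝ) * lam / (√γ * k ^ 2)) := by gcongr
    _ = 8 * (γ + 1) * (γ + 2) * (√(s : ℝ) * √(s : ℝ)) * lam / (γ * √γ * k ^ 2) := by
        field_simp
        ring
    _ = _ := by rw [Real.mul_self_sqrt (Nat.cast_nonneg s), hpow]

end Oracle

section Lasso

variable {Ω : Type*} {mΩ : MeasurableSpace Ω} {P : Measure Ω} [IsProbabilityMeasure P]
  {ℱ : Filtration ℝ≥0 mΩ} {p d : ℕ} {Θ : Set (E p)} {b : E p → E d → E d} {θ₀ : E p}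
  {W X : ℝ≥0 → Ω → E d} {T : ℝ≥0} {I : E p → Ω → ℝ} {J : E p → Fin p → Ω → ℝ}

/-- On `𝒯`, almost surely and for all parameters at once, `θ ↦ ∫₀ᵀ b_θ(X_t)⋆ dW_t` is Lipschitz
with constant `T λ / 2` for the `ℓ₁`-norm. -/
lemma ae_forall_abs_sub_le_of_mem_gradEvent (hΘ : IsOpen Θ) (hΘc : Convex ℝ Θ)
    (hb : IsRegularDrift Θ b) (hθ₀ : θ₀ ∈ Θ) (hW : IsBrownianMotion ℱ P W)
    (hX : IsSolution ℱ P (b θ₀) W X) (hT : 0 < T)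
    (hI : ∀ θ ∈ Θ, IsItoIntegral ℱ P T X (fun t ω => b θ (X t ω)) (I θ))
    (hI_sep : IsSeparableField Θ P I)
    (hJ : ∀ θ ∈ Θ, ∀ j, IsItoIntegral ℱ P T W (fun t ω => driftDeriv b θ j (X t ω)) (J θ j))
    (lam : ℝ) :
    ∀ᵐ ω ∂P, ω ∈ gradEvent Θ T J lam → ∀ θ ∈ Θ, ∀ ϑ ∈ Θ,
      |(I θ ω + ∫ t in (0 : ℝ)..T, inner ℝ (b θ (X t.toNNReal ω)) (b θ₀ (X t.toNNReal ω))) -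
        (I ϑ ω + ∫ t in (0 : ℝ)..T, inner ℝ (b ϑ (X t.toNNReal ω)) (b θ₀ (X t.toNNReal ω)))| ≤
        T * (lam / 2) * l1 (θ - ϑ) := by
  obtain ⟨D, hDc, hD, hsep⟩ := hI_sep
  have hM : ∀ θ ∈ Θ, _ := fun θ hθ =>
    (hI θ hθ).add_drift hW (hb.continuous hθ₀) (hb.continuous hθ) hX
  have hpairs := (ae_ball_iff hDc).2 fun θ hθ => (ae_ball_iff hDc).2 fun ϑ hϑ =>
    ae_abs_sub_le_of_mem_gradEvent hΘ hΘc hb hW hX.continuous_paths hT hJ lam (hD hϑ) (hD hθ)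
      (hM θ (hD hθ)) (hM ϑ (hD hϑ))
  filter_upwards [hpairs, hsep, hX.continuous_paths] with ω h1 h2 h3 hgrad
  exact abs_sub_le_of_dense_graph hD (I := fun θ => I θ ω)
    (hb.continuousOn_integral_inner hΘ (hb.continuous hθ₀) T h3) h2
    fun θ hθ ϑ hϑ => h1 θ hθ ϑ hϑ hgrad

/-- The basic inequality of the Lasso, for one path. -/
lemma basic_inequality {ω : Ω} (hx : Continuous fun t => X t ω) (hT : 0 < T)
    {lam : ℝ} {θ η : E p} (hθ : Continuous (b θ)) (hη : Continuous (b η))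
    (hθ₀ : Continuous (b θ₀))
    (hmin : negLogLik b X T I η ω + lam * l1 η ≤ negLogLik b X T I θ ω + lam * l1 θ)
    (hlam : 0 < lam)
    (hM : |(I η ω + ∫ t in (0 : ℝ)..T, inner ℝ (b η (X t.toNNReal ω)) (b θ₀ (X t.toNNReal ω))) -
        (I θ ω + ∫ t in (0 : ℝ)..T, inner ℝ (b θ (X t.toNNReal ω)) (b θ₀ (X t.toNNReal ω)))| ≤
        T * (lam / 2) * l1 (η - θ)) :
    pathNorm T (fun t => X t ω) (fun y => b η y - b θ₀ y) ^ 2 + lam * l1 (η - θ) ≤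
      pathNorm T (fun t => X t ω) (fun y => b θ y - b θ₀ y) ^ 2 +
        4 * lam * ∑ j with θ j ≠ 0, |(η - θ) j| := by
  have hT0 : (0 : ℝ) < T := by exact_mod_cast hT
  rw [negLogLik_eq hx hη hθ₀, negLogLik_eq hx hθ hθ₀] at hmin
  have h1 := (abs_le.1 hM).1
  have h2 := mul_le_mul_of_nonneg_left h1 (by positivity : (0 : ℝ) ≤ 1 / T)
  have e : 1 / (T : ℝ) * -(T * (lam / 2) * l1 (η - θ)) = -(lam / 2 * l1 (η - θ)) := by
    field_simp
  rw [e, mul_sub] at h2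
  have h3 := mul_le_mul_of_nonneg_left (l1_sub_l1_add_le θ η) hlam.le
  rw [mul_add, mul_sub] at h3
  linarith

end Lasso

end

end LassoDiffusion

theorem theorem3p2 {Ω : Type*} {mΩ : MeasurableSpace Ω} (P : Measure Ω) [IsProbabilityMeasure P]
    (ℱ : Filtration ℝ≥0 mΩ) {p d : ℕ}
    (Θ : Set (LassoDiffusion.E p)) (hΘ_open : IsOpen Θ) (hΘ_convex : Convex ℝ Θ)
    (b : LassoDiffusion.E p → LassoDiffusion.E d → LassoDiffusion.E d)
    (hb : LassoDiffusion.IsRegularDrift Θ b)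
    (θ₀ : LassoDiffusion.E p) (hθ₀ : θ₀ ∈ Θ)
    (W X : ℝ≥0 → Ω → LassoDiffusion.E d)
    (hW : LassoDiffusion.IsBrownianMotion ℱ P W)
    (hX : LassoDiffusion.IsSolution ℱ P (b θ₀) W X)
    (T : ℝ≥0) (hT : 0 < T)
    (I : LassoDiffusion.E p → Ω → ℝ)
    (hI : ∀ θ ∈ Θ, LassoDiffusion.IsItoIntegral ℱ P T X (fun t ω => b θ (X t ω)) (I θ))
    (hI_sep : LassoDiffusion.IsSeparableField Θ P I)
    (J : LassoDiffusion.E p → Fin p → Ω → ℝ)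
    (hJ : ∀ θ ∈ Θ, ∀ j, LassoDiffusion.IsItoIntegral ℱ P T W
      (fun t ω => LassoDiffusion.driftDeriv b θ j (X t ω)) (J θ j))
    (lam γ k : ℝ) (hlam : 0 < lam) (hγ : 0 < γ) (hk : 0 < k) (s : ℕ)
    (θhat : Ω → LassoDiffusion.E p)
    (hθhat : LassoDiffusion.IsLasso Θ P (LassoDiffusion.negLogLik b X T I) lam θhat) :
    ∀ᵐ ω ∂P, ω ∈ LassoDiffusion.gradEvent Θ T J lam ∩ LassoDiffusion.eigenEvent Θ b X T s γ k →
      (∀ θ ∈ Θ, LassoDiffusion.l0 θ = s →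
        LassoDiffusion.pathNorm T (fun t => X t ω) (fun x => b (θhat ω) x - b θ₀ x) ^ 2 ≤
          (1 + γ) * LassoDiffusion.pathNorm T (fun t => X t ω) (fun x => b θ x - b θ₀ x) ^ 2 +
            4 * ((γ + 2) ^ 2 * (s : ℝ) * lam ^ 2) / (γ * k ^ 2)) ∧
      (LassoDiffusion.l0 θ₀ = s →
        LassoDiffusion.pathNorm T (fun t => X t ω) (fun x => b (θhat ω) x - b θ₀ x) ^ 2 ≤
            4 * ((γ + 2) ^ 2 * (s : ℝ) * lam ^ 2) / (γ * k ^ 2) ∧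
        ‖θhat ω - θ₀‖ ^ 2 ≤ 4 * ((γ + 2) ^ 2 * (s : ℝ) * lam ^ 2) / (γ * k ^ 4) ∧
        LassoDiffusion.l1 (θhat ω - θ₀) ≤
            4 * (γ + 1) / γ * Real.sqrt (s : ℝ) * ‖θhat ω - θ₀‖ ∧
        LassoDiffusion.l1 (θhat ω - θ₀) ≤
            8 * (γ + 1) * (γ + 2) * (s : ℝ) * lam / (γ ^ (3 / 2 : ℝ) * k ^ 2)) := by
  filter_upwards [LassoDiffusion.ae_forall_abs_sub_le_of_mem_gradEvent hΘ_open hΘ_convex hb hθ₀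
    hW hX hT hI hI_sep hJ lam, hθhat, hX.continuous_paths] with ω hLip hmin hx hω
  obtain ⟨hη, hmin⟩ := hmin
  have hcont : ∀ θ ∈ Θ, Continuous (b θ) := fun θ hθ => hb.continuous hθ
  have hbasic : ∀ θ ∈ Θ, _ := fun θ hθ =>
    LassoDiffusion.basic_inequality hx hT (hcont θ hθ) (hcont _ hη) (hcont _ hθ₀) (hmin θ hθ) hlam
      (hLip hω.1 _ hη θ hθ)
  have heig : ∀ θ ∈ Θ, LassoDiffusion.l0 θ = s →
      θ - θhat ω ∈ LassoDiffusion.cone p s (3 + 4 / γ) → k * ‖θhat ω - θ‖ ≤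
        LassoDiffusion.pathNorm T (fun t => X t ω) (fun x => b θ x - b (θhat ω) x) := by
    intro θ hθ hs hc
    have h := hω.2 θ hθ _ hη hs hc
    rwa [le_div_iff₀ (norm_pos_iff.2 hc.1), norm_sub_rev] at h
  have horacle : ∀ θ ∈ Θ, LassoDiffusion.l0 θ = s →
      LassoDiffusion.pathNorm T (fun t => X t ω) (fun x => b (θhat ω) x - b θ₀ x) ^ 2 ≤
        (1 + γ) * LassoDiffusion.pathNorm T (fun t => X t ω) (fun x => b θ x - b θ₀ x) ^ 2 +
          4 * ((γ + 2) ^ 2 * (s : ℝ) * lam ^ 2) / (γ * k ^ 2) := fun θ hθ hs =>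
    LassoDiffusion.oracle_of_basic hγ hk hlam hs (sq_nonneg _) (sq_nonneg _) (hbasic θ hθ)
      (heig θ hθ hs)
      (LassoDiffusion.pathNorm_sub_sq_le hx (hcont θ hθ) (hcont _ hη) (hcont _ hθ₀))
  refine ⟨horacle, fun hs => ?_⟩
  -- with `θ₀` itself as the oracle its approximation error `‖b_{θ₀} - b_{θ₀}‖_T` vanishes
  have hzero : LassoDiffusion.pathNorm T (fun t => X t ω) (fun x => b θ₀ x - b θ₀ x) ^ 2 = 0 := by
    simp [LassoDiffusion.pathNorm_sq]
  have hA := horacle θ₀ hθ₀ hs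
  have hb₀ := hbasic θ₀ hθ₀
  rw [hzero, mul_zero, zero_add] at hA
  rw [hzero, zero_add] at hb₀
  have hsymm : LassoDiffusion.pathNorm T (fun t => X t ω) (fun x => b θ₀ x - b (θhat ω) x) =
      LassoDiffusion.pathNorm T (fun t => X t ω) (fun x => b (θhat ω) x - b θ₀ x) := by
    simp only [LassoDiffusion.pathNorm, LassoDiffusion.pathInner, real_inner_self_eq_norm_sq,
      norm_sub_rev (b θ₀ _)]
  have he := heig θ₀ hθ₀ hs
  rw [hsymm] at he
  exact ⟨hA, LassoDiffusion.error_bounds_of_basic hγ hk hlam hs (Real.sqrt_nonneg _) hb₀ he hA⟩
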